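/- **Lemma 3.3 (exponential convergence rate of $P$).** Let $\mathcal H,\mathcal U,\mathcal Y$ be complex Hilbert spaces, let $A:D(A)\to\mathcal H$ be the generator of a strongly continuous semigroup on $\mathcal H$, and let $B\in L(\mathcal U,\mathcal H)$, $C\in L(\mathcal H,\mathcal Y)$ and $K\in L(\mathcal U,\mathcal H)$, where $K$ is coercive: there is $m>0$ with $\langle K^*Ku,u\rangle\ge m\|u\|^2$ for all $u\in\mathcal U$. Inner products are linear in the first argument. A family $P:[0,\tau]\to L(\mathcal H)$ of self-adjoint operators with $P(\cdot)x$ continuous for every $x\in\mathcal H$ is a (weak) solution on $[0,\tau]$ of the differential Riccati equation with $P(0)=0$ if $P(0)=0$ and, for all $x,y\in D(A)$, the function $\langle P(t)x,y\rangle$ is differentiable on $[0,\tau]$ with $$\frac{d}{dt}\langle P(t)x,y\rangle=\langle P(t)x,Ay\rangle+\langle P(t)Ax,y\rangle-\langle (K^*K)^{-1}B^*P(t)x,B^*P(t)y\rangle+\langle Cx,Cy\rangle ,\qquad t\in[0,\tau].$$ A self-adjoint $P\in L(\mathcal H)$ is a solution of the algebraic Riccati equation if, for all $x,y\in D(A)$,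 $$\langle Px,Ay\rangle+\langle PAx,y\rangle-\langle (K^*K)^{-1}B^*Px,B^*Py\rangle+\langle Cx,Cy\rangle=0 .$$ Assume that $(A,B)$ is exponentially stabilizable (there is $F\in L(\mathcal H,\mathcal U)$ such that $A+BF$ generates an exponentially stable semigroup) and that $(A,C)$ is exponentially detectable (there is $L\in L(\mathcal Y,\mathcal H)$ such that $A+LC$ generates an exponentially stable semigroup). Then the algebraic Riccati equation has a minimal non-negative solution $P_{\min}$, that is, a non-negative solution with $P_{\min}\le Q$ for every non-negative solution $Q$; there is a family $P:[0,\infty)\to L(\mathcal H)$ of non-negative operators which on every interval $[0,\tau]$, $\tau>0$, is the unique solution of the differential Riccati equation with $P(0)=0$; and there exist constants $M,\beta>0$ such that $$\|P_{\min}-P(t)\|\le Me^{-\beta t}\qquad\text{for all } t\ge 0,$$ in the operator norm. -/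

import Mathlib

open Set Filter Topology
open scoped InnerProduct

section RiccatiDefs

variable {H U Y : Type*}
  [NormedAddCommGroup H] [InnerProductSpace ℂ H] [CompleteSpace H]
  [NormedAddCommGroup U] [InnerProductSpace ℂ U] [CompleteSpace U]
  [NormedAddCommGroup Y] [InnerProductSpace ℂ Y] [CompleteSpace Y]

/-- `T` restricted to `[0, ∞)` is a strongly continuous semigroup of bounded operators on `H`
(the values of `T` at negative times are irrelevant). -/
structure IsC0Semigroup (T : ℝ → H →L[ℂ] H) : Prop where
  map_zero : T 0 = 1
  map_add : ∀ s t : ℝ, 0 ≤ s → 0 ≤ t → T (s + t) = T s * T t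
  continuousOn : ∀ x : H, ContinuousOn (fun t => T t x) (Ici 0)

/-- The (unbounded) operator `A` is the generator of the strongly continuous semigroup `T`:
`x ∈ D(A)` and `A x = y` if and only if `(T h x - x) / h → y` as `h → 0+`. -/
structure IsGenerator (A : H →ₗ.[ℂ] H) (T : ℝ → H →L[ℂ] H) : Prop where
  isC0Semigroup : IsC0Semigroup T
  mem_graph_iff : ∀ x y : H, (x, y) ∈ A.graph ↔
    Tendsto (fun h : ℝ => h⁻¹ • (T h x - x)) (𝓝[>] 0) (𝓝 y)

/-- `A` generates an exponentially stable strongly continuous semigroup. -/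
def GeneratesExpStable (A : H →ₗ.[ℂ] H) : Prop :=
  ∃ S : ℝ → H →L[ℂ] H, IsGenerator A S ∧
    ∃ M > (0 : ℝ), ∃ ω > (0 : ℝ), ∀ t : ℝ, 0 ≤ t → ‖S t‖ ≤ M * Real.exp (-ω * t)

/-- `(A, B)` is exponentially stabilizable: for some bounded `F`, the operator `A + B F`
(with domain `D(A)`) generates an exponentially stable semigroup. -/
def ExpStabilizable (A : H →ₗ.[ℂ] H) (B : U →L[ℂ] H) : Prop :=
  ∃ F : H →L[ℂ] U, GeneratesExpStable (((B ∘L F : H →L[ℂ] H) : H →ₗ[ℂ] H) +ᵥ A)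

/-- `(A, C)` is exponentially detectable: for some bounded `L`, the operator `A + L C`
(with domain `D(A)`) generates an exponentially stable semigroup. -/
def ExpDetectable (A : H →ₗ.[ℂ] H) (C : H →L[ℂ] Y) : Prop :=
  ∃ L : Y →L[ℂ] H, GeneratesExpStable (((L ∘L C : H →L[ℂ] H) : H →ₗ[ℂ] H) +ᵥ A)

/-- `K` is coercive: `⟨K* K u, u⟩ ≥ m ‖u‖²` for some `m > 0` (the left side is real). -/
def IsCoerciveOp (K : U →L[ℂ] H) : Prop :=
  ∃ m > (0 : ℝ), ∀ u : U, m * ‖u‖ ^ 2 ≤ RCLike.re (inner ℂ u ((K† ∘L K) u))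

/-- The bounded operator `(K* K)⁻¹`; for coercive `K` the operator `K* K` is invertible. -/
noncomputable def gramInv (K : U →L[ℂ] H) : U →L[ℂ] U :=
  (K† ∘L K).inverse

/-- `P` is a weak solution on `[0, T]` of the differential Riccati equation
`P' - A* P - P A + P B (K* K)⁻¹ B* P - C* C = 0`, `P 0 = P₀`: it is a strongly continuous family
of bounded self-adjoint operators, and for `x, y ∈ D(A)` the function `t ↦ ⟨P(t) x, y⟩` is
differentiable on `[0, T]` (one-sidedly at the end points) with
`d/dt ⟨P x, y⟩ = ⟨P x, A y⟩ + ⟨P A x, y⟩ - ⟨(K* K)⁻¹ B* P x, B* P y⟩ + ⟨C x, C y⟩`.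
Here `⟨a, b⟩`, linear in `a`, is `inner ℂ b a`. -/
structure IsDRESolution (A : H →ₗ.[ℂ] H) (B : U →L[ℂ] H) (C : H →L[ℂ] Y) (K : U →L[ℂ] H)
    (P₀ : H →L[ℂ] H) (T : ℝ) (P : ℝ → H →L[ℂ] H) : Prop where
  isSelfAdjoint : ∀ t ∈ Icc 0 T, IsSelfAdjoint (P t)
  continuousOn : ∀ x : H, ContinuousOn (fun t => P t x) (Icc 0 T)
  initial : P 0 = P₀
  hasDeriv : ∀ x y : A.domain, ∀ t ∈ Icc 0 T,
    HasDerivWithinAt (fun s => inner ℂ (y : H) (P s x))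
      (inner ℂ (A y) (P t x) + inner ℂ (y : H) (P t (A x))
        - inner ℂ ((B†) (P t y)) (gramInv K ((B†) (P t x)))
        + inner ℂ (C y) (C x))
      (Icc 0 T) t

/-- `P` is a (bounded, self-adjoint) solution of the algebraic Riccati equation
`A* P + P A - P B (K* K)⁻¹ B* P + C* C = 0`, understood weakly on `D(A)`. -/
structure IsARESolution (A : H →ₗ.[ℂ] H) (B : U →L[ℂ] H) (C : H →L[ℂ] Y) (K : U →L[ℂ] H)
    (P : H →L[ℂ] H) : Prop where
  isSelfAdjoint : IsSelfAdjoint P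
  equation : ∀ x y : A.domain,
    inner ℂ (A y) (P x) + inner ℂ (y : H) (P (A x))
      - inner ℂ ((B†) (P y)) (gramInv K ((B†) (P x)))
      + inner ℂ (C y) (C x) = 0

/-- `P` is the minimal non-negative solution of the algebraic Riccati equation: the least one
for the order `P ≤ Q ↔ Q - P` is positive semidefinite. -/
def IsMinNonnegARESolution (A : H →ₗ.[ℂ] H) (B : U →L[ℂ] H) (C : H →L[ℂ] Y) (K : U →L[ℂ] H)
    (P : H →L[ℂ] H) : Prop :=
  P.IsPositive ∧ IsARESolution A B C K P ∧
    ∀ Q : H →L[ℂ] H, Q.IsPositive → IsARESolution A B C K Q → (Q - P).IsPositive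

end RiccatiDefs

/-! The quantity `⟨P(t)x₀, x₀⟩` is the least cost `∫₀ᵗ ‖Ku‖² + ‖Cx‖²` over controls of `x' = Ax +
Bu`, `x(0) = x₀`. This is encoded by completing the square along a trajectory: the derivative of
`⟨P(t-s)x(s), x(s)⟩` in `s` is `‖K(u + (K*K)⁻¹B*P(t-s)x)‖² - ‖Ku‖² - ‖Cx‖²`
(`IsWeakRiccati.hasDerivWithinAt_control`). Trajectories need not stay in `D(A)`, so the weak
equation is first rewritten in terms of the semigroup, where the unbounded terms cancel
(`IsWeakRiccati.tendsto_slope`).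

Subtracting this identity for two solutions, along the trajectory optimal for one of them, gives
`IsWeakRiccati.comparison`; order preservation, uniqueness and monotonicity in time follow.
Inserting a stabilizing feedback bounds `P(t)` uniformly (`exists_norm_le_of_stabilizable`), and
this bound turns local existence by contraction (`exists_local_riccati`) into global existence.

For the rate, `P(t+r) - P(t)` is non-negative, and comparison along the trajectory `x` optimal for
horizon `t` bounds its form at `x(0)` by the form of `P(t-s+r) - P(t-s)` at `x(s)`. Detectability
yields a time `N`, independent of `t ≥ N` and `x(0)`, before which `‖x(s)‖²` has dropped to half of
`‖x(0)‖²` (`exists_time_norm_sq_le_half`). Hence each delay by `N` halves the bound on the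
difference, uniformly in `r` (`norm_sub_le_geometric`). So `P` is Cauchy in operator norm, its limit
solves the algebraic equation, and the limit is minimal because a non-negative stationary solution
starts above `P(0) = 0` and stays above `P`. -/

set_option linter.unusedSectionVars false

/-! ### Right derivatives and averages over short intervals. -/

section RightDerivative

variable {E : Type*} [NormedAddCommGroup E] [NormedSpace ℝ E]

theorem hasDerivWithinAt_Ici_iff_tendsto {f : ℝ → E} {f' : E} {s : ℝ} :
    HasDerivWithinAt f f' (Ici s) s ↔
      Tendsto (fun k : ℝ => k⁻¹ • (f (s + k) - f s)) (𝓝[>] 0) (𝓝 f') := by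
  rw [← hasDerivWithinAt_Ioi_iff_Ici, hasDerivWithinAt_iff_tendsto_slope' (by simp)]
  have h1 : map (fun k : ℝ => s + k) (𝓝[>] 0) = 𝓝[>] s := by
    simp
  rw [← h1, tendsto_map'_iff]
  have : (slope f s ∘ fun k : ℝ => s + k) = fun k : ℝ => k⁻¹ • (f (s + k) - f s) := by
    ext k
    simp [slope_def_module]
  rw [this]

/-- Averages over shrinking intervals of a jointly continuous function. -/
theorem tendsto_average_integral [CompleteSpace E] {F : ℝ → ℝ → E} (hF : Continuous (Function.uncurry F)) :
    Tendsto (fun k : ℝ => k⁻¹ • ∫ r in (0 : ℝ)..k, F k r) (𝓝[>] 0) (𝓝 (F 0 0)) := by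
  rw [Metric.tendsto_nhds]
  intro ε hε
  have hc : ContinuousAt (Function.uncurry F) (0, 0) := hF.continuousAt
  obtain ⟨δ, hδ, hd⟩ := Metric.continuousAt_iff.1 hc (ε / 2) (by positivity)
  filter_upwards [Ioo_mem_nhdsGT hδ] with k hk
  have hk0 : (0 : ℝ) < k := hk.1
  have hFk : Continuous (F k) := hF.comp (by fun_prop : Continuous fun r : ℝ => (k, r))
  have hsub : k⁻¹ • (∫ r in (0 : ℝ)..k, F k r) - F 0 0
      = k⁻¹ • ∫ r in (0 : ℝ)..k, (F k r - F 0 0) := by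
    rw [intervalIntegral.integral_sub (hFk.intervalIntegrable _ _) (by simp)]
    simp [smul_sub, smul_smul, inv_mul_cancel₀ hk0.ne']
  rw [dist_eq_norm, hsub, norm_smul]
  have hb : ‖∫ r in (0 : ℝ)..k, (F k r - F 0 0)‖ ≤ ε / 2 * |k - 0| := by
    apply intervalIntegral.norm_integral_le_of_norm_le_const
    intro r hr
    rw [uIoc_of_le hk0.le] at hr
    have := @hd (k, r) (by
      simp only [Prod.dist_eq, Real.dist_eq, sub_zero, sup_lt_iff]
      exact ⟨by rw [abs_of_pos hk0]; exact hk.2, by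
        rw [abs_of_pos hr.1]; exact hr.2.trans_lt hk.2⟩)
    simpa [dist_eq_norm] using this.le
  rw [sub_zero, abs_of_pos hk0] at hb
  calc ‖k⁻¹‖ * _ ≤ k⁻¹ * (ε / 2 * k) := by
        rw [Real.norm_of_nonneg (by positivity)]; gcongr
    _ = ε / 2 := by field_simp
    _ < ε := by linarith

theorem tendsto_average_integral_add [CompleteSpace E] {F : ℝ → ℝ → E}
    (hF : Continuous (Function.uncurry F)) (t : ℝ) :
    Tendsto (fun k : ℝ => k⁻¹ • ∫ r in (0 : ℝ)..k, F (t + k) (t + r)) (𝓝[>] 0) (𝓝 (F t t)) := by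
  have h : Continuous (Function.uncurry fun k r => F (t + k) (t + r)) :=
    hF.comp (by fun_prop : Continuous fun p : ℝ × ℝ => (t + p.1, t + p.2))
  simpa using tendsto_average_integral h

theorem le_of_rightDeriv_nonpos {f f' : ℝ → ℝ} {a b : ℝ} (hab : a ≤ b)
    (hf : ContinuousOn f (Icc a b))
    (hd : ∀ s ∈ Ico a b, HasDerivWithinAt f (f' s) (Ici s) s)
    (hle : ∀ s ∈ Ico a b, f' s ≤ 0) : f b ≤ f a :=
  image_le_of_deriv_right_le_deriv_boundary (B := fun _ => f a) (B' := fun _ => 0) hf hd le_rfl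
    continuousOn_const (fun _ _ => hasDerivWithinAt_const _ _ _) hle (right_mem_Icc.2 hab)

end RightDerivative

/-! ### Strongly continuous operator families. -/

section StronglyContinuous

variable {X E F : Type*} [TopologicalSpace X]
  [NormedAddCommGroup E] [NormedSpace ℂ E] [NormedAddCommGroup F] [NormedSpace ℂ F]

/-- Orbits are bounded on a compact set by continuity, so uniform boundedness applies. This replaces
norm continuity, which is not available. -/
theorem exists_norm_le_of_isCompact [CompleteSpace E] {A : X → E →L[ℂ] F} {k : Set X}
    (hk : IsCompact k) (hA : ∀ x, ContinuousOn (fun p => A p x) k) :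
    ∃ c, 0 ≤ c ∧ ∀ p ∈ k, ‖A p‖ ≤ c := by
  obtain ⟨c, hc⟩ := banach_steinhaus (g := fun p : k => A p) (fun x => by
    obtain ⟨c, hc⟩ := hk.exists_bound_of_continuousOn (hA x)
    exact ⟨c, fun p => hc p p.2⟩)
  exact ⟨max c 0, le_max_right _ _, fun p hp => (hc ⟨p, hp⟩).trans (le_max_left _ _)⟩

theorem tendsto_family_apply {ι : Type*} {l : Filter ι} {A : ι → E →L[ℂ] F} {f : ι → E} {c : ℝ}
    {y : E} {z : F} (hb : ∀ᶠ p in l, ‖A p‖ ≤ c) (hA : Tendsto (fun p => A p y) l (𝓝 z))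
    (hf : Tendsto f l (𝓝 y)) : Tendsto (fun p => A p (f p)) l (𝓝 z) := by
  have h0 : Tendsto (fun p => A p (f p - y)) l (𝓝 0) := by
    have h1 : Tendsto (fun p => c * ‖f p - y‖) l (𝓝 0) := by
      have := (tendsto_iff_norm_sub_tendsto_zero.1 hf).const_mul c
      simpa using this
    refine squeeze_zero_norm' ?_ h1
    filter_upwards [hb] with p hp
    exact ((A p).le_opNorm _).trans (by gcongr)
  have := h0.add hA
  simpa using this

theorem continuous_family_apply [WeaklyLocallyCompactSpace X] [CompleteSpace E]
    {A : X → E →L[ℂ] F} {f : X → E}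
    (hA : ∀ x, Continuous fun p => A p x) (hf : Continuous f) :
    Continuous fun p => A p (f p) := by
  rw [continuous_iff_continuousAt]
  intro p
  obtain ⟨k, hk, hkp⟩ := exists_compact_mem_nhds p
  obtain ⟨c, -, hc⟩ := exists_norm_le_of_isCompact hk (fun x => (hA x).continuousOn (s := k))
  exact tendsto_family_apply (c := c) (by filter_upwards [hkp] with q hq using hc q hq)
    (hA (f p)).continuousAt hf.continuousAt

theorem tendsto_family_of_dense {ι : Type*} {l : Filter ι} {A : ι → E →L[ℂ] F} {D : E →L[ℂ] F}
    {c : ℝ} {s : Set E} (hs : Dense s) (hb : ∀ᶠ p in l, ‖A p‖ ≤ c)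
    (hA : ∀ x ∈ s, Tendsto (fun p => A p x) l (𝓝 (D x))) (x : E) :
    Tendsto (fun p => A p x) l (𝓝 (D x)) := by
  rw [Metric.tendsto_nhds]
  intro ε hε
  set d := |c| + ‖D‖ + 1 with hd
  have hdpos : 0 < d := by positivity
  obtain ⟨y, hys, hy⟩ := Metric.mem_closure_iff.1 (hs x) (ε / (2 * d)) (by positivity)
  filter_upwards [hb, Metric.tendsto_nhds.1 (hA y hys) (ε / 2) (by positivity)] with p hp hpy
  rw [dist_eq_norm] at hy hpy ⊢
  have e : A p x - D x = A p (x - y) - D (x - y) + (A p y - D y) := by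
    simp only [map_sub]; abel
  rw [e]
  have h1 : ‖A p (x - y)‖ ≤ |c| * ‖x - y‖ :=
    ((A p).le_opNorm _).trans (by gcongr; exact hp.trans (le_abs_self c))
  have h2 : ‖D (x - y)‖ ≤ ‖D‖ * ‖x - y‖ := D.le_opNorm _
  have h3 : d * ‖x - y‖ ≤ ε / 2 := by
    calc d * ‖x - y‖ ≤ d * (ε / (2 * d)) := by gcongr
      _ = ε / 2 := by field_simp
  have h4 := norm_add_le (A p (x - y) - D (x - y)) (A p y - D y)
  have h5 := norm_sub_le (A p (x - y)) (D (x - y))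
  nlinarith [norm_nonneg (x - y)]

end StronglyContinuous

/-! ### Semigroups, Duhamel's formula and bounded perturbations. -/

section Semigroup

variable {H : Type*} [NormedAddCommGroup H] [InnerProductSpace ℂ H] [CompleteSpace H]

/-- A strongly continuous semigroup extended by the identity to negative times. -/
structure IsExtendedSemigroup (T : ℝ → H →L[ℂ] H) : Prop extends IsC0Semigroup T where
  of_nonpos : ∀ t ≤ 0, T t = 1

/-- Clamping time at `0` makes orbits continuous on all of `ℝ`, which removes sign conditions from
continuity arguments. The generator only sees small positive times and is unaffected. -/
theorem IsC0Semigroup.extend {T : ℝ → H →L[ℂ] H} (hT : IsC0Semigroup T) :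
    IsExtendedSemigroup fun t => T (max t 0) where
  map_zero := by simpa using hT.map_zero
  map_add s t hs ht := by
    simpa [max_eq_left hs, max_eq_left ht, max_eq_left (add_nonneg hs ht)] using hT.map_add s t hs ht
  continuousOn x := (hT.continuousOn x).comp (by fun_prop) (fun t _ => le_max_right t 0)
  of_nonpos t ht := by simpa [max_eq_right ht] using hT.map_zero

theorem IsGenerator.extend {A : H →ₗ.[ℂ] H} {T : ℝ → H →L[ℂ] H} (hA : IsGenerator A T) :
    IsGenerator A fun t => T (max t 0) where
  isC0Semigroup := hA.isC0Semigroup.extend.toIsC0Semigroup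
  mem_graph_iff x y := by
    rw [hA.mem_graph_iff]
    apply tendsto_congr'
    filter_upwards [self_mem_nhdsWithin] with h hh
    rw [max_eq_left (le_of_lt hh)]

variable {T S : ℝ → H →L[ℂ] H}

namespace IsExtendedSemigroup

theorem continuous_apply (hT : IsExtendedSemigroup T) (x : H) : Continuous fun t => T t x := by
  have h : (fun t => T t x) = (fun t => T t x) ∘ fun t => max t 0 := by
    ext t
    rcases le_total t 0 with ht | ht
    · simp [hT.of_nonpos t ht, max_eq_right ht, hT.map_zero]
    · simp [max_eq_left ht]
  rw [h, ← continuousOn_univ]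
  exact (hT.continuousOn x).comp (by fun_prop) (fun t _ => le_max_right t 0)

theorem continuous_comp (hT : IsExtendedSemigroup T) {X : Type*} [TopologicalSpace X]
    [WeaklyLocallyCompactSpace X] {g : X → ℝ} {f : X → H} (hg : Continuous g) (hf : Continuous f) :
    Continuous fun p => T (g p) (f p) :=
  continuous_family_apply (A := fun p => T (g p)) (fun x => (hT.continuous_apply x).comp hg) hf

theorem map_add_apply (hT : IsExtendedSemigroup T) {s t : ℝ} (hs : 0 ≤ s) (ht : 0 ≤ t) (x : H) :
    T (s + t) x = T s (T t x) := by
  rw [hT.map_add s t hs ht]; rfl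

theorem exists_norm_le (hT : IsExtendedSemigroup T) (b : ℝ) :
    ∃ c, 1 ≤ c ∧ ∀ t ≤ b, ‖T t‖ ≤ c := by
  obtain ⟨c, -, hc⟩ := exists_norm_le_of_isCompact (A := T) (isCompact_Icc (a := 0) (b := b))
    (fun x => (hT.continuous_apply x).continuousOn)
  refine ⟨max c 1, le_max_right _ _, fun t ht => ?_⟩
  rcases le_total t 0 with h0 | h0
  · rw [hT.of_nonpos t h0]
    exact (ContinuousLinearMap.norm_id_le).trans (le_max_right _ _)
  · exact (hc t ⟨h0, ht⟩).trans (le_max_left _ _)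

theorem tendsto_zero (hT : IsExtendedSemigroup T) (x : H) :
    Tendsto (fun t => T t x) (𝓝[>] 0) (𝓝 x) := by
  have := ((hT.continuous_apply x).tendsto 0).mono_left (nhdsWithin_le_nhds (s := Ioi 0))
  simpa [hT.map_zero] using this

/-- Variation of constants: if `x` has forcing `f` in the infinitesimal sense, then it is
given by Duhamel's formula. -/
theorem duhamel (hT : IsExtendedSemigroup T) {x f : ℝ → H} {t : ℝ} (ht : 0 ≤ t)
    (hx : Continuous x) (hf : Continuous f)
    (hd : ∀ s ∈ Ico 0 t, Tendsto (fun k : ℝ => k⁻¹ • (x (s + k) - T k (x s))) (𝓝[>] 0) (𝓝 (f s))) :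
    x t = T t (x 0) + ∫ r in (0 : ℝ)..t, T (t - r) (f r) := by
  have hcont : Continuous fun r => T (t - r) (x r) := hT.continuous_comp (by fun_prop) hx
  have hcont' : Continuous fun r => T (t - r) (f r) := hT.continuous_comp (by fun_prop) hf
  -- The formula is the fundamental theorem of calculus for `r ↦ T (t - r) (x r)`. By the semigroup
  -- law its increment from `s` to `s + k` is `T (t - s - k)` applied to `x (s + k) - T k (x s)`.
  have key := intervalIntegral.integral_eq_sub_of_hasDeriv_right (a := 0) (b := t)
    (f := fun r => T (t - r) (x r)) (f' := fun r => T (t - r) (f r)) hcont.continuousOn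
    (fun s hs => ?_) (hcont'.intervalIntegrable _ _)
  · rw [key]; simp [hT.map_zero]
  rw [min_eq_left ht, max_eq_right ht] at hs
  rw [hasDerivWithinAt_Ioi_iff_Ici, hasDerivWithinAt_Ici_iff_tendsto]
  obtain ⟨c, -, hc⟩ := hT.exists_norm_le t
  have h1 : Tendsto (fun k : ℝ => T (t - (s + k)) (k⁻¹ • (x (s + k) - T k (x s)))) (𝓝[>] 0)
      (𝓝 (T (t - s) (f s))) := by
    refine tendsto_family_apply (A := fun k : ℝ => T (t - (s + k))) (c := c) ?_ ?_
      (hd s ⟨hs.1.le, hs.2⟩)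
    · filter_upwards [self_mem_nhdsWithin] with k (hk : 0 < k)
      exact hc _ (by linarith [hs.1])
    · have := ((hT.continuous_comp (by fun_prop : Continuous fun k : ℝ => t - (s + k))
        (continuous_const (y := f s))).tendsto 0).mono_left (nhdsWithin_le_nhds (s := Ioi 0))
      simpa using this
  refine h1.congr' ?_
  filter_upwards [Ioo_mem_nhdsGT (sub_pos.2 hs.2)] with k hk
  rw [ContinuousLinearMap.map_smul_of_tower, map_sub, ← hT.map_add_apply (by linarith [hk.2]) hk.1.le]
  congr 4
  ring

end IsExtendedSemigroup

namespace IsGenerator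

variable {A : H →ₗ.[ℂ] H}

theorem tendsto_apply (hA : IsGenerator A T) (x : A.domain) :
    Tendsto (fun h : ℝ => h⁻¹ • (T h x - x)) (𝓝[>] 0) (𝓝 (A x)) :=
  (hA.mem_graph_iff _ _).1 (A.mem_graph x)

theorem exists_domain (hA : IsGenerator A T) {x y : H}
    (h : Tendsto (fun h : ℝ => h⁻¹ • (T h x - x)) (𝓝[>] 0) (𝓝 y)) :
    ∃ z : A.domain, (z : H) = x ∧ A z = y :=
  (A.mem_graph_iff).1 ((hA.mem_graph_iff x y).2 h)

theorem exists_semigroup_apply (hA : IsGenerator A T) (x : A.domain) {s : ℝ} (hs : 0 ≤ s) :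
    ∃ z : A.domain, (z : H) = T s x ∧ A z = T s (A x) := by
  apply hA.exists_domain
  have h := ((T s).continuous.tendsto _).comp (hA.tendsto_apply x)
  refine h.congr' ?_
  filter_upwards [self_mem_nhdsWithin] with k (hk : 0 < k)
  have e : T k (T s x) = T s (T k x) := by
    have h1 := hA.isC0Semigroup.map_add k s hk.le hs
    have h2 := hA.isC0Semigroup.map_add s k hs hk.le
    rw [add_comm, h2] at h1
    exact (DFunLike.congr_fun h1 _).symm
  simp only [Function.comp, ContinuousLinearMap.map_smul_of_tower, map_sub, e]

/-- The averages `k⁻¹ ∫₀ᵏ T r x` belong to the domain and converge to `x`. -/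
theorem dense_domain (hA : IsGenerator A T) (hT : IsExtendedSemigroup T) :
    Dense (A.domain : Set H) := by
  have hmem : ∀ x : H, ∀ h : ℝ, 0 ≤ h → ∫ r in (0 : ℝ)..h, T r x ∈ A.domain := by
    intro x h hh
    have hc := hT.continuous_apply x
    have hi : ∀ a b, IntervalIntegrable (fun r => T r x) MeasureTheory.volume a b :=
      fun a b => hc.intervalIntegrable a b
    suffices hs : Tendsto (fun k : ℝ => k⁻¹ • (T k (∫ r in (0 : ℝ)..h, T r x)
        - ∫ r in (0 : ℝ)..h, T r x)) (𝓝[>] 0) (𝓝 (T h x - T 0 x)) by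
      obtain ⟨z, hz, -⟩ := hA.exists_domain hs
      rw [← hz]; exact z.2
    have hd : ∀ a, Tendsto (fun k : ℝ => k⁻¹ • ∫ r in (0 : ℝ)..k, T (a + r) x) (𝓝[>] 0)
        (𝓝 (T a x)) := fun a => by
      have := tendsto_average_integral (F := fun _ r => T (a + r) x)
        (by exact hc.comp (by fun_prop : Continuous fun p : ℝ × ℝ => a + p.2))
      simpa using this
    refine ((hd h).sub (hd 0)).congr' ?_
    filter_upwards [self_mem_nhdsWithin] with k (hk : 0 < k)
    rw [← smul_sub]
    congr 1
    have e1 : T k (∫ r in (0 : ℝ)..h, T r x) = ∫ r in (0 : ℝ)..h, T (k + r) x := by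
      rw [← ContinuousLinearMap.intervalIntegral_comp_comm _ (hi 0 h)]
      refine intervalIntegral.integral_congr fun r hr => ?_
      rw [uIcc_of_le hh] at hr
      exact (hT.map_add_apply hk.le hr.1 x).symm
    rw [e1, intervalIntegral.integral_comp_add_left (fun r => T r x),
      intervalIntegral.integral_comp_add_left (fun r => T r x),
      intervalIntegral.integral_comp_add_left (fun r => T r x)]
    simp only [add_zero, zero_add]
    rw [← intervalIntegral.integral_add_adjacent_intervals (hi k h) (hi h (k + h)),
      ← intervalIntegral.integral_add_adjacent_intervals (hi 0 k) (hi k h), add_comm h k]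
    abel
  intro x
  have hlim : Tendsto (fun k : ℝ => k⁻¹ • ∫ r in (0 : ℝ)..k, T r x) (𝓝[>] 0) (𝓝 x) := by
    have := tendsto_average_integral (F := fun _ r => T r x)
      (by exact (hT.continuous_apply x).comp continuous_snd)
    simpa [hT.map_zero] using this
  refine mem_closure_of_tendsto hlim ?_
  filter_upwards [self_mem_nhdsWithin] with k (hk : 0 < k)
  exact A.domain.smul_of_tower_mem _ (hmem x k hk.le)

/-- Bounded perturbations of generators differ from the original semigroup to first order. -/
theorem tendsto_perturbation (hA : IsGenerator A T) (hT : IsExtendedSemigroup T)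
    {D : H →L[ℂ] H} (hS : IsGenerator ((D : H →ₗ[ℂ] H) +ᵥ A) S) (hSe : IsExtendedSemigroup S)
    (x : H) : Tendsto (fun k : ℝ => k⁻¹ • (S k x - T k x)) (𝓝[>] 0) (𝓝 (D x)) := by
  obtain ⟨c, hc1, hc⟩ := hT.exists_norm_le 1
  obtain ⟨c', hc1', hc'⟩ := hSe.exists_norm_le 1
  have hdom : ∀ z : A.domain, Tendsto (fun k : ℝ => k⁻¹ • (S k z - T k z)) (𝓝[>] 0)
      (𝓝 (D z)) := by
    intro z
    have h1 := hS.tendsto_apply z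
    rw [LinearPMap.vadd_apply] at h1
    have := h1.sub (hA.tendsto_apply z)
    simpa [← smul_sub] using this
  -- On the domain, which `S` preserves, Duhamel's formula bounds `k⁻¹ (S k - T k)` by a constant
  -- independent of `k`. Density extends first this bound and then the limit to all of `H`.
  have hform : ∀ z : A.domain, ∀ k : ℝ, 0 ≤ k →
      S k z = T k z + ∫ r in (0 : ℝ)..k, T (k - r) (D (S r z)) := by
    intro z k hk
    have := hT.duhamel hk (hSe.continuous_apply z)
      (D.continuous.comp (hSe.continuous_apply z)) (fun s hs => by
        obtain ⟨w, hw, -⟩ := hS.exists_semigroup_apply z hs.1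
        refine (by simpa [hw] using hdom w : Tendsto _ _ (𝓝 (D (S s z)))).congr' ?_
        filter_upwards [self_mem_nhdsWithin] with k (hk : 0 < k)
        rw [add_comm s k, hSe.map_add_apply hk.le hs.1])
    simpa [hSe.map_zero] using this
  refine tendsto_family_of_dense (A := fun k : ℝ => k⁻¹ • (S k - T k)) (c := c * (‖D‖ * c'))
    (hA.dense_domain hT) ?_ (fun x hx => hdom ⟨x, hx⟩) x
  filter_upwards [Ioc_mem_nhdsGT (zero_lt_one' ℝ)] with k hk
  refine ContinuousLinearMap.opNorm_le_bound _ (by positivity) fun x => ?_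
  have hcl : IsClosed {x : H | ‖(k⁻¹ • (S k - T k)) x‖ ≤ c * (‖D‖ * c') * ‖x‖} :=
    isClosed_le (by fun_prop) (by fun_prop)
  refine hcl.closure_subset_iff.2 ?_ ((hA.dense_domain hT) x)
  intro z hz
  have hz' := hform ⟨z, hz⟩ k hk.1.le
  simp only [mem_ofPred_eq, smul_apply, sub_apply]
  simp only at hz'
  rw [hz', add_sub_cancel_left, norm_smul, Real.norm_of_nonneg (by have := hk.1; positivity)]
  have hb : ‖∫ r in (0 : ℝ)..k, T (k - r) (D (S r z))‖ ≤ c * (‖D‖ * c') * ‖z‖ * |k - 0| := by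
    apply intervalIntegral.norm_integral_le_of_norm_le_const
    intro r hr
    rw [uIoc_of_le hk.1.le] at hr
    calc ‖T (k - r) (D (S r z))‖ ≤ c * (‖D‖ * (c' * ‖z‖)) := by
          refine ((T (k - r)).le_opNorm _).trans ?_
          gcongr
          · exact hc _ (by linarith [hk.2, hr.1])
          · refine (D.le_opNorm _).trans ?_
            gcongr
            refine ((S r).le_opNorm _).trans ?_
            gcongr
            exact hc' _ (hr.2.trans hk.2)
      _ = c * (‖D‖ * c') * ‖z‖ := by ring
  rw [sub_zero, abs_of_pos hk.1] at hb
  have hk0 := hk.1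
  calc k⁻¹ * _ ≤ k⁻¹ * (c * (‖D‖ * c') * ‖z‖ * k) := by gcongr
    _ = c * (‖D‖ * c') * ‖z‖ := by field_simp

end IsGenerator

end Semigroup

/-! ### Strong continuity of the adjoint semigroup. -/

section AdjointSemigroup

variable {H : Type*} [NormedAddCommGroup H] [InnerProductSpace ℂ H] [CompleteSpace H]
  {T V : ℝ → H →L[ℂ] H}

/-- A semigroup bounded near zero that is strongly continuous from the right at zero is
strongly continuous. -/
theorem continuousOn_of_tendsto_zero {x : H} (h0 : V 0 = 1)
    (hadd : ∀ s t : ℝ, 0 ≤ s → 0 ≤ t → V (s + t) = V s * V t)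
    (hb : ∀ b : ℝ, ∃ c, 1 ≤ c ∧ ∀ t ≤ b, ‖V t‖ ≤ c)
    (hx : Tendsto (fun t => V t x) (𝓝[>] 0) (𝓝 x)) : ContinuousOn (fun t => V t x) (Ici 0) := by
  have hx' : Tendsto (fun t => V t x) (𝓝[≥] 0) (𝓝 x) := by
    have : ContinuousWithinAt (fun t => V t x) (Ioi 0) 0 := by
      simpa [ContinuousWithinAt, h0] using hx
    have := continuousWithinAt_Ioi_iff_Ici.1 this
    simpa [ContinuousWithinAt, h0] using this
  intro t ht
  have ht : (0 : ℝ) ≤ t := ht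
  obtain ⟨c, hc1, hc⟩ := hb (t + 1)
  have hfil : 𝓝[≥] t ⊔ 𝓝[≤] t = 𝓝 t := by rw [sup_comm, nhdsLE_sup_nhdsGE]
  have hnorm : ∀ s, 0 ≤ s → s ≤ t + 1 → ‖V s x - V t x‖ ≤ c * ‖V |s - t| x - x‖ := by
    intro s hs hst
    rcases le_total t s with h | h
    · have e : V s x = V t (V (s - t) x) := by
        have := hadd t (s - t) ht (by linarith)
        rw [add_sub_cancel] at this
        rw [this]; rfl
      rw [abs_of_nonneg (by linarith), e, ← map_sub]
      exact ((V t).le_opNorm _).trans (by gcongr; exact hc _ (by linarith))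
    · have e : V t x = V s (V (t - s) x) := by
        have := hadd s (t - s) hs (by linarith)
        rw [add_sub_cancel] at this
        rw [this]; rfl
      rw [abs_of_nonpos (by linarith), e, ← map_sub, neg_sub, norm_sub_rev (V (t - s) x) x]
      exact ((V s).le_opNorm _).trans (by gcongr; exact hc _ hst)
  have hsq : Tendsto (fun s : ℝ => c * ‖V |s - t| x - x‖) (𝓝[≥] t ⊔ 𝓝[≤] t) (𝓝 0) := by
    rw [hfil]
    have habs' : Tendsto (fun s : ℝ => |s - t|) (𝓝 t) (𝓝[≥] 0) := by
      refine tendsto_nhdsWithin_iff.2 ⟨?_, Eventually.of_forall fun s => mem_Ici.2 (abs_nonneg _)⟩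
      have : Tendsto (fun s : ℝ => |s - t|) (𝓝 t) (𝓝 |t - t|) :=
        (by fun_prop : Continuous fun s : ℝ => |s - t|).tendsto t
      simpa using this
    have := ((tendsto_iff_norm_sub_tendsto_zero.1 hx').comp habs').const_mul c
    simpa using this
  rw [hfil] at hsq
  refine tendsto_iff_norm_sub_tendsto_zero.2 (squeeze_zero' (Eventually.of_forall fun s =>
    norm_nonneg _) ?_ (hsq.mono_left nhdsWithin_le_nhds))
  filter_upwards [self_mem_nhdsWithin,
    nhdsWithin_le_nhds (Iio_mem_nhds (lt_add_one t))] with s hs hs1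
  exact hnorm s hs (le_of_lt hs1)

/-- The adjoint of a strongly continuous semigroup on a Hilbert space is strongly continuous. -/
theorem IsExtendedSemigroup.adjoint (hT : IsExtendedSemigroup T) :
    IsExtendedSemigroup fun t => (T t)† := by
  have hadd : ∀ s t : ℝ, 0 ≤ s → 0 ≤ t → (T (s + t))† = (T s)† * (T t)† := by
    intro s t hs ht
    rw [add_comm, hT.map_add t s ht hs]
    exact ContinuousLinearMap.adjoint_comp _ _
  have hone : (1 : H →L[ℂ] H)† = 1 := by
    rw [← ContinuousLinearMap.star_eq_adjoint]; exact star_one _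
  have hb : ∀ b : ℝ, ∃ c, 1 ≤ c ∧ ∀ t ≤ b, ‖(T t)†‖ ≤ c := fun b => by
    simpa using hT.exists_norm_le b
  suffices h0 : ∀ x, Tendsto (fun t => ((T t)†) x) (𝓝[>] 0) (𝓝 x) from
    { map_zero := by rw [hT.map_zero, hone]
      map_add := hadd
      continuousOn := fun x => continuousOn_of_tendsto_zero (V := fun t => (T t)†)
        (by simp only [hT.map_zero, hone]) hadd hb (h0 x)
      of_nonpos := fun t ht => by rw [hT.of_nonpos t ht, hone] }
  -- `W` consists of the vectors at which the adjoint semigroup is right continuous at zero. It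
  -- contains the range of the adjoint of `R = ∫₀ʰ T r`. A vector `z` orthogonal to `W` then
  -- satisfies `R z = 0` for all small `h`, and dividing by `h` gives `z = 0`.
  let W : Submodule ℂ H :=
    { carrier := {x | Tendsto (fun t => ((T t)†) x) (𝓝[>] 0) (𝓝 x)}
      add_mem' := fun {x y} hx hy => by
        have := Tendsto.add (show Tendsto _ _ _ from hx) (show Tendsto _ _ _ from hy)
        simpa using this
      zero_mem' := by simp
      smul_mem' := fun a x hx => by
        have := Tendsto.const_smul (show Tendsto _ _ _ from hx) a
        simpa using this }
  obtain ⟨c, hc1, hc⟩ := hb 1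
  -- Times up to `2` occur because both the averaging length `h` and the shift `k` range up to `1`.
  obtain ⟨c', -, hc'⟩ := hT.exists_norm_le 2
  suffices hW : Dense (W : Set H) by
    refine tendsto_family_of_dense (A := fun t => (T t)†) (D := ContinuousLinearMap.id ℂ H)
      (c := c) hW ?_ (fun x hx => hx)
    filter_upwards [Ioc_mem_nhdsGT (zero_lt_one' ℝ)] with k hk using hc k hk.2
  rw [Submodule.dense_iff_topologicalClosure_eq_top, Submodule.topologicalClosure_eq_top_iff,
    Submodule.eq_bot_iff]
  intro z hz
  have hi : ∀ x a b, IntervalIntegrable (fun r => T r x) MeasureTheory.volume a b :=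
    fun x a b => (hT.continuous_apply x).intervalIntegrable a b
  have hR : ∀ h : ℝ, h ∈ Ioc (0 : ℝ) 1 → ∫ r in (0 : ℝ)..h, T r z = 0 := by
    intro h hh
    let R : H →L[ℂ] H := LinearMap.mkContinuous
      { toFun := fun x => ∫ r in (0 : ℝ)..h, T r x
        map_add' := fun x y => by
          simp only [map_add]
          exact intervalIntegral.integral_add (hi x 0 h) (hi y 0 h)
        map_smul' := fun a x => by
          simp only [map_smul, RingHom.id_apply]
          exact intervalIntegral.integral_smul a _ } (c' * h) (fun x => by
        have hbd : ‖∫ r in (0 : ℝ)..h, T r x‖ ≤ c' * ‖x‖ * |h - 0| := by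
          apply intervalIntegral.norm_integral_le_of_norm_le_const
          intro r hr
          rw [uIoc_of_le hh.1.le] at hr
          exact (T r).le_of_opNorm_le (hc' _ (by linarith [hr.2, hh.2])) x
        rw [sub_zero, abs_of_pos hh.1] at hbd
        exact hbd.trans_eq (by ring))
    have hRx : ∀ x, R x = ∫ r in (0 : ℝ)..h, T r x := fun x => rfl
    -- The difference `R ∘ T k - R` is a difference of integrals over two intervals of length `k`,
    -- so its norm, and that of its adjoint, is of order `k`.
    have hcomm : ∀ k ∈ Ioc (0 : ℝ) 1, ‖R ∘L T k - R‖ ≤ 2 * c' * k := by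
      intro k hk
      have hk0 := hk.1
      have hcp : 0 ≤ c' := (norm_nonneg _).trans (hc' 0 (by norm_num))
      refine ContinuousLinearMap.opNorm_le_bound _ (by positivity) fun x => ?_
      have e1 : R (T k x) = ∫ r in (0 : ℝ)..h, T (r + k) x := by
        rw [hRx]
        refine intervalIntegral.integral_congr fun r hr => ?_
        rw [uIcc_of_le hh.1.le] at hr
        exact (hT.map_add_apply hr.1 hk.1.le x).symm
      have e2 : (R ∘L T k - R) x = (∫ r in h..(h + k), T r x) - ∫ r in (0 : ℝ)..k, T r x := by
        have : (R ∘L T k - R) x = R (T k x) - R x := rfl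
        rw [this, e1, hRx, intervalIntegral.integral_comp_add_right (fun r => T r x), zero_add,
          ← intervalIntegral.integral_add_adjacent_intervals (hi x k h) (hi x h (h + k)),
          ← intervalIntegral.integral_add_adjacent_intervals (hi x 0 k) (hi x k h)]
        abel
      have hbd : ∀ a : ℝ, a ≤ 1 → ‖∫ r in a..(a + k), T r x‖ ≤ c' * ‖x‖ * k := by
        intro a ha
        have : ‖∫ r in a..(a + k), T r x‖ ≤ c' * ‖x‖ * |a + k - a| := by
          apply intervalIntegral.norm_integral_le_of_norm_le_const
          intro r hr
          rw [uIoc_of_le (by linarith)] at hr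
          exact (T r).le_of_opNorm_le (hc' _ (by linarith [hr.2, hk.2])) x
        rwa [add_sub_cancel_left, abs_of_pos hk.1] at this
      have h0 := hbd 0 zero_le_one
      rw [zero_add] at h0
      rw [e2]
      calc _ ≤ _ := norm_sub_le _ _
        _ ≤ c' * ‖x‖ * k + c' * ‖x‖ * k := add_le_add (hbd h hh.2) h0
        _ = 2 * c' * k * ‖x‖ := by ring
    have hmem : ∀ y, (R†) y ∈ W := by
      intro y
      change Tendsto (fun t => ((T t)†) ((R†) y)) (𝓝[>] 0) (𝓝 ((R†) y))
      have hlim : Tendsto (fun k : ℝ => 2 * c' * k * ‖y‖) (𝓝[>] 0) (𝓝 0) := by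
        have : Tendsto (fun k : ℝ => 2 * c' * k * ‖y‖) (𝓝 0) (𝓝 (2 * c' * 0 * ‖y‖)) :=
          (by fun_prop : Continuous fun k : ℝ => 2 * c' * k * ‖y‖).tendsto 0
        simpa using this.mono_left nhdsWithin_le_nhds
      refine tendsto_iff_norm_sub_tendsto_zero.2 (squeeze_zero' (Eventually.of_forall fun s =>
        norm_nonneg _) ?_ hlim)
      filter_upwards [Ioc_mem_nhdsGT (zero_lt_one' ℝ)] with k hk
      have e : ((T k)†) ((R†) y) - (R†) y = ((R ∘L T k - R)†) y := by
        rw [map_sub, ContinuousLinearMap.adjoint_comp]; rfl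
      rw [e]
      exact ContinuousLinearMap.le_of_opNorm_le _
        (by rw [LinearIsometryEquiv.norm_map]; exact hcomm k hk) y
    have : inner ℂ (R z) (R z) = 0 := by
      rw [← ContinuousLinearMap.adjoint_inner_left]
      exact (Submodule.mem_orthogonal _ _).1 hz _ (hmem _)
    exact inner_self_eq_zero.1 this
  have hlim : Tendsto (fun k : ℝ => k⁻¹ • ∫ r in (0 : ℝ)..k, T r z) (𝓝[>] 0) (𝓝 z) := by
    have := tendsto_average_integral (F := fun _ r => T r z)
      (by exact (hT.continuous_apply z).comp continuous_snd)
    simpa [hT.map_zero] using this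
  refine tendsto_nhds_unique hlim (tendsto_const_nhds.congr' ?_)
  filter_upwards [Ioc_mem_nhdsGT (zero_lt_one' ℝ)] with k hk
  rw [hR k hk, smul_zero]

end AdjointSemigroup

/-! ### Trajectories in the semigroup sense and closed loops. -/

section Trajectory

variable {H : Type*} [NormedAddCommGroup H] [InnerProductSpace ℂ H] [CompleteSpace H]
  {T S : ℝ → H →L[ℂ] H} {x f : ℝ → H} {t : ℝ}

/-- `x` solves `x' = A x + f` on `[0, t)`, expressed through the semigroup `T` generated by `A`. -/
structure IsTrajectory (T : ℝ → H →L[ℂ] H) (x f : ℝ → H) (t : ℝ) : Prop where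
  continuous : Continuous x
  continuous_forcing : Continuous f
  tendsto : ∀ s ∈ Ico 0 t,
    Tendsto (fun k : ℝ => k⁻¹ • (x (s + k) - T k (x s))) (𝓝[>] 0) (𝓝 (f s))

theorem IsTrajectory.duhamel (h : IsTrajectory T x f t) (hT : IsExtendedSemigroup T) {s : ℝ}
    (hs : s ∈ Icc 0 t) : x s = T s (x 0) + ∫ r in (0 : ℝ)..s, T (s - r) (f r) :=
  hT.duhamel hs.1 h.continuous h.continuous_forcing
    fun r hr => h.tendsto r ⟨hr.1, hr.2.trans_le hs.2⟩

/-- A trajectory stays a trajectory under a bounded perturbation of the generator. -/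
theorem IsTrajectory.perturb (h : IsTrajectory T x f t) {D : H →L[ℂ] H}
    (hD : ∀ x, Tendsto (fun k : ℝ => k⁻¹ • (S k x - T k x)) (𝓝[>] 0) (𝓝 (D x))) :
    IsTrajectory S x (fun s => f s - D (x s)) t where
  continuous := h.continuous
  continuous_forcing := h.continuous_forcing.sub (D.continuous.comp h.continuous)
  tendsto s hs := by
    refine ((h.tendsto s hs).sub (hD (x s))).congr fun k => ?_
    rw [← smul_sub]
    congr 1
    abel

theorem IsExtendedSemigroup.isTrajectory (hS : IsExtendedSemigroup S) {D : H →L[ℂ] H}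
    (hD : ∀ x, Tendsto (fun k : ℝ => k⁻¹ • (S k x - T k x)) (𝓝[>] 0) (𝓝 (D x))) (x₀ : H) (t : ℝ) :
    IsTrajectory T (fun s => S s x₀) (fun s => D (S s x₀)) t where
  continuous := hS.continuous_apply x₀
  continuous_forcing := D.continuous.comp (hS.continuous_apply x₀)
  tendsto s hs := by
    refine (hD (S s x₀)).congr' ?_
    filter_upwards [self_mem_nhdsWithin] with k (hk : 0 < k)
    rw [add_comm s k, hS.map_add_apply hk.le hs.1]

/-- By the semigroup law, `x (s + k) - T k (x s)` is the integral of `T (k - r) (f (s + r))` over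
`[0, k]`; its average tends to `f s`. -/
theorem isTrajectory_of_duhamel (hT : IsExtendedSemigroup T) (hx : Continuous x)
    (hf : Continuous f)
    (h : ∀ s ∈ Icc 0 t, x s = T s (x 0) + ∫ r in (0 : ℝ)..s, T (s - r) (f r)) :
    IsTrajectory T x f t where
  continuous := hx
  continuous_forcing := hf
  tendsto s hs := by
    have hc : Continuous (Function.uncurry fun k r => T (k - r) (f (s + r))) :=
      hT.continuous_comp (by fun_prop) (by fun_prop)
    have hav := tendsto_average_integral hc
    simp only [sub_zero, add_zero, hT.map_zero] at hav
    refine hav.congr' ?_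
    filter_upwards [Ioo_mem_nhdsGT (sub_pos.2 hs.2)] with k hk
    have hi : ∀ a b c, IntervalIntegrable (fun r => T (c - r) (f r)) MeasureTheory.volume a b :=
      fun a b c => (hT.continuous_comp (by fun_prop) hf).intervalIntegrable a b
    congr 1
    have e1 : T k (∫ r in (0 : ℝ)..s, T (s - r) (f r))
        = ∫ r in (0 : ℝ)..s, T (s + k - r) (f r) := by
      rw [← ContinuousLinearMap.intervalIntegral_comp_comm _ (hi 0 s s)]
      refine intervalIntegral.integral_congr fun r hr => ?_
      rw [uIcc_of_le hs.1] at hr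
      change T k (T (s - r) (f r)) = T (s + k - r) (f r)
      rw [← hT.map_add_apply hk.1.le (by linarith [hr.2])]
      congr 2; ring
    have e2 : ∫ r in (0 : ℝ)..k, T (k - r) (f (s + r))
        = ∫ r in s..(s + k), T (s + k - r) (f r) := by
      have := intervalIntegral.integral_comp_add_left (a := 0) (b := k)
        (fun r => T (s + k - r) (f r)) s
      simpa using this
    rw [h (s + k) ⟨by linarith [hs.1, hk.1], by linarith [hk.2]⟩, h s ⟨hs.1, hs.2.le⟩, map_add, e1,
      add_comm s k, hT.map_add_apply hk.1.le hs.1, add_comm k s, e2,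
      ← intervalIntegral.integral_add_adjacent_intervals (hi 0 s _) (hi s (s + k) _)]
    abel

theorem integral_exp_neg_mul_le {l s : ℝ} (hl : 0 < l) :
    ∫ r in (0 : ℝ)..s, Real.exp (-(l * (s - r))) ≤ 1 / l := by
  have hd : ∀ r ∈ uIcc 0 s, HasDerivAt (fun r => Real.exp (-(l * (s - r))) / l)
      (Real.exp (-(l * (s - r)))) r := by
    intro r _
    have h1 : HasDerivAt (fun r => -(l * (s - r))) l r := by
      have := (((hasDerivAt_id r).const_sub s).const_mul l).fun_neg
      simpa using this
    have := h1.exp.div_const l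
    simpa [hl.ne'] using this
  rw [intervalIntegral.integral_eq_sub_of_hasDerivAt hd
    ((by fun_prop : Continuous fun r => Real.exp (-(l * (s - r)))).intervalIntegrable _ _)]
  simp only [sub_self, mul_zero, neg_zero, Real.exp_zero, sub_zero]
  have := Real.exp_pos (-(l * s))
  have : 0 < Real.exp (-(l * s)) / l := by positivity
  linarith

/-- Linear time-varying feedback: the closed loop equation has a solution. -/
theorem exists_closedLoop (hT : IsExtendedSemigroup T) {N : ℝ → H →L[ℂ] H}
    (hN : ∀ z, Continuous fun s => N s z) (ht : 0 ≤ t) (x₀ : H) :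
    ∃ x : ℝ → H, x 0 = x₀ ∧ IsTrajectory T x (fun s => N s (x s)) t := by
  obtain ⟨c, hc1, hc⟩ := hT.exists_norm_le t
  obtain ⟨n, hn0, hn⟩ := exists_norm_le_of_isCompact (A := N) (isCompact_Icc (a := 0) (b := t))
    (fun x => (hN x).continuousOn)
  -- In the weighted unknown `exp (-l s) x(s)` the Duhamel map has Lipschitz constant at most `c n /
  -- l ≤ 1/2`, so a single contraction covers all of `[0, t]`.
  set l : ℝ := 2 * (c * n + 1) with hl
  have hl0 : 0 < l := by positivity
  let ext : C(Icc 0 t, H) → ℝ → H := fun z s => z (projIcc 0 t ht s)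
  have hext : ∀ z, Continuous (ext z) := fun z => z.continuous.comp continuous_projIcc
  let F : C(Icc 0 t, H) → ℝ → ℝ → H :=
    fun z s r => Real.exp (-(l * (s - r))) • T (s - r) (N r (ext z r))
  have hF : ∀ z, Continuous (Function.uncurry (F z)) := by
    intro z
    have h1 : Continuous fun p : ℝ × ℝ => N p.2 (ext z p.2) :=
      continuous_family_apply (A := fun p : ℝ × ℝ => N p.2)
        (fun x => (hN x).comp continuous_snd) ((hext z).comp continuous_snd)
    have h2 : Continuous fun p : ℝ × ℝ => Real.exp (-(l * (p.1 - p.2))) := by fun_prop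
    exact h2.smul (hT.continuous_comp (by fun_prop) h1)
  have hFi : ∀ z s a b, IntervalIntegrable (F z s) MeasureTheory.volume a b := fun z s a b =>
    ((hF z).comp (by fun_prop : Continuous fun r : ℝ => (s, r))).intervalIntegrable a b
  let G : C(Icc 0 t, H) → C(Icc 0 t, H) := fun z =>
    ⟨fun s => Real.exp (-(l * s)) • T s x₀ + ∫ r in (0 : ℝ)..s, F z s r, by
      have h2 : Continuous fun s : Icc 0 t => Real.exp (-(l * (s : ℝ))) := by fun_prop
      refine Continuous.add (h2.smul
        ((hT.continuous_apply x₀).comp continuous_subtype_val)) ?_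
      exact (intervalIntegral.continuous_parametric_intervalIntegral_of_continuous (hF z)
        continuous_id).comp continuous_subtype_val⟩
  have hG : ContractingWith (1 / 2) G := by
    refine ⟨by rw [← NNReal.coe_lt_coe]; norm_num, LipschitzWith.of_dist_le_mul fun z w => ?_⟩
    rw [ContinuousMap.dist_le (by positivity)]
    intro s
    have hs := s.2
    have e : G z s - G w s = ∫ r in (0 : ℝ)..s, (F z s r - F w s r) := by
      rw [intervalIntegral.integral_sub (hFi _ _ _ _) (hFi _ _ _ _)]
      simp [G]
    rw [dist_eq_norm, e]
    have hb : ‖∫ r in (0 : ℝ)..s, (F z s r - F w s r)‖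
        ≤ ∫ r in (0 : ℝ)..s, (c * n * dist z w) * Real.exp (-(l * (s - r))) := by
      refine intervalIntegral.norm_integral_le_of_norm_le hs.1
        (Eventually.of_forall fun r hr => ?_)
        ((by fun_prop : Continuous fun r : ℝ =>
          (c * n * dist z w) * Real.exp (-(l * (s - r)))).intervalIntegrable _ _)
      have e2 : F z s r - F w s r
          = Real.exp (-(l * (s - r))) • T (s - r) (N r (ext z r - ext w r)) := by
        simp only [F, map_sub, smul_sub]
      rw [e2, norm_smul, Real.norm_of_nonneg (Real.exp_nonneg _), mul_comm]
      gcongr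
      calc _ ≤ c * (n * dist z w) := by
            refine (ContinuousLinearMap.le_of_opNorm_le _ (hc _ (by linarith [hr.1, hs.2])) _).trans ?_
            gcongr
            refine (ContinuousLinearMap.le_of_opNorm_le _
              (hn _ ⟨hr.1.le, hr.2.trans hs.2⟩) _).trans ?_
            gcongr
            rw [← dist_eq_norm]
            exact ContinuousMap.dist_apply_le_dist _
        _ = _ := by ring
    refine hb.trans ?_
    rw [intervalIntegral.integral_const_mul]
    have h1 := integral_exp_neg_mul_le (s := s) hl0
    have h2 : c * n * (1 / l) ≤ 1 / 2 := by
      rw [hl]; field_simp; linarith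
    calc c * n * dist z w * _ ≤ c * n * dist z w * (1 / l) := by gcongr
      _ = c * n * (1 / l) * dist z w := by ring
      _ ≤ 1 / 2 * dist z w := by gcongr
      _ = _ := by simp
  obtain ⟨z, hz⟩ : ∃ z, G z = z := ⟨_, hG.fixedPoint_isFixedPt⟩
  -- The weight is removed from the fixed point.
  let x : ℝ → H := fun s => Real.exp (l * s) • ext z s
  have hx : Continuous x :=
    (by fun_prop : Continuous fun s : ℝ => Real.exp (l * s)).smul (hext z)
  have hxs : ∀ s ∈ Icc 0 t, x s = T s x₀ + ∫ r in (0 : ℝ)..s, T (s - r) (N r (x r)) := by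
    intro s hs
    have h1 : ext z s = G z ⟨s, hs⟩ := by simp only [ext, projIcc_of_mem ht hs, hz]
    have h2 : Real.exp (l * s) * Real.exp (-(l * s)) = 1 := by rw [← Real.exp_add]; simp
    simp only [x, h1]
    change Real.exp (l * s) • (Real.exp (-(l * s)) • T s x₀ + ∫ r in (0 : ℝ)..s, F z s r) = _
    rw [smul_add, smul_smul, h2, one_smul, ← intervalIntegral.integral_smul]
    congr 1
    refine intervalIntegral.integral_congr fun r _ => ?_
    simp only [F, smul_smul, ContinuousLinearMap.map_smul_of_tower]
    congr 1
    rw [← Real.exp_add]; congr 1; ring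
  have hx0 : x 0 = x₀ := by
    rw [hxs 0 ⟨le_rfl, ht⟩]; simp [hT.map_zero]
  refine ⟨x, hx0, isTrajectory_of_duhamel hT hx (continuous_family_apply hN hx) fun s hs => ?_⟩
  rw [hx0]
  exact hxs s hs

end Trajectory

/-! ### The weak Riccati equation and its energy balance. -/

section Riccati

variable {H : Type*} [NormedAddCommGroup H] [InnerProductSpace ℂ H] [CompleteSpace H]
  {A : H →ₗ.[ℂ] H} {S Q : H →L[ℂ] H} {T P : ℝ → H →L[ℂ] H} {τ t : ℝ}

/-- Weak solutions of the operator Riccati equation `P' = A* P + P A - P S P + Q` on `[0, τ]`,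
extended to a strongly continuous family on the real line. -/
structure IsWeakRiccati (A : H →ₗ.[ℂ] H) (S Q : H →L[ℂ] H) (τ : ℝ) (P : ℝ → H →L[ℂ] H) :
    Prop where
  continuous : ∀ x, Continuous fun t => P t x
  isSelfAdjoint : ∀ t ∈ Icc 0 τ, IsSelfAdjoint (P t)
  hasDeriv : ∀ x y : A.domain, ∀ t ∈ Icc 0 τ,
    HasDerivWithinAt (fun s => inner ℂ (y : H) (P s x))
      (inner ℂ (A y) (P t x) + inner ℂ (y : H) (P t (A x)) - inner ℂ (P t y) (S (P t x))
        + inner ℂ (y : H) (Q x)) (Icc 0 τ) t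

/-- A product rule for sesquilinear expressions along first-order approximations. -/
theorem tendsto_slope_inner {R : ℝ → H →L[ℂ] H} {a b α β : ℝ → H} {a₀ β₀ a' b' : H} {e d : ℂ}
    (hR : ∀ x, Continuous fun k => R k x)
    (ha : Tendsto (fun k : ℝ => k⁻¹ • (a k - α k)) (𝓝[>] 0) (𝓝 a'))
    (hb : Tendsto (fun k : ℝ => k⁻¹ • (b k - β k)) (𝓝[>] 0) (𝓝 b'))
    (ha₀ : Tendsto a (𝓝[>] 0) (𝓝 a₀)) (hβ₀ : Tendsto β (𝓝[>] 0) (𝓝 β₀))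
    (hd : Tendsto (fun k : ℝ => k⁻¹ • (inner ℂ (β k) (R k (α k)) - e)) (𝓝[>] 0) (𝓝 d)) :
    Tendsto (fun k : ℝ => k⁻¹ • (inner ℂ (b k) (R k (a k)) - e)) (𝓝[>] 0)
      (𝓝 (inner ℂ b' (R 0 a₀) + inner ℂ β₀ (R 0 a') + d)) := by
  obtain ⟨c, -, hc⟩ := exists_norm_le_of_isCompact (A := R) (isCompact_Icc (a := 0) (b := 1))
    (fun x => (hR x).continuousOn)
  have hc' : ∀ᶠ k : ℝ in 𝓝[>] 0, ‖R k‖ ≤ c := by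
    filter_upwards [Ioc_mem_nhdsGT (zero_lt_one' ℝ)] with k hk using hc k ⟨hk.1.le, hk.2⟩
  have hR0 : ∀ x, Tendsto (fun k => R k x) (𝓝[>] 0) (𝓝 (R 0 x)) := fun x =>
    ((hR x).tendsto 0).mono_left nhdsWithin_le_nhds
  have h1 := hb.inner (𝕜 := ℂ) (tendsto_family_apply hc' (hR0 a₀) ha₀)
  have h2 := hβ₀.inner (𝕜 := ℂ) (tendsto_family_apply hc' (hR0 a') ha)
  refine ((h1.add h2).add hd).congr fun k => ?_
  simp only [← Complex.coe_smul, inner_smul_left, inner_smul_right, map_smul, smul_eq_mul,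
    map_sub, inner_sub_left, inner_sub_right, Complex.conj_ofReal]
  ring

theorem tendsto_slope_of_hasDerivWithinAt_Icc {E : Type*} [NormedAddCommGroup E] [NormedSpace ℝ E]
    {f : ℝ → E} {f' : E} (ht : t ∈ Ioc 0 τ)
    (h : HasDerivWithinAt f f' (Icc 0 τ) t) :
    Tendsto (fun k : ℝ => k⁻¹ • (f (t - k) - f t)) (𝓝[>] 0) (𝓝 (-f')) := by
  have h1 : HasDerivWithinAt (fun k : ℝ => t - k) (-1) (Icc 0 t) 0 := by
    simpa using ((hasDerivAt_id (0 : ℝ)).const_sub t).hasDerivWithinAt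
  have hmaps : MapsTo (fun k : ℝ => t - k) (Icc 0 t) (Icc 0 τ) :=
    fun k hk => ⟨by linarith [hk.2], by linarith [hk.1, ht.2]⟩
  have h2 := HasDerivWithinAt.scomp (g₁ := f) (h := fun k : ℝ => t - k) (0 : ℝ)
    (by simpa using h) h1 hmaps
  have h3 : HasDerivWithinAt (f ∘ fun k : ℝ => t - k) (-f') (Ici 0) 0 := by
    simpa using h2.mono_of_mem_nhdsWithin (Icc_mem_nhdsGE ht.1)
  simpa using hasDerivWithinAt_Ici_iff_tendsto.1 h3

namespace IsWeakRiccati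

theorem inner_comm' (hP : IsWeakRiccati A S Q τ P) (ht : t ∈ Icc 0 τ) (x y : H) :
    inner ℂ (P t x) y = inner ℂ x (P t y) :=
  (hP.isSelfAdjoint t ht).isSymmetric x y

/-- The generator terms produced by `T k` acting on `x` and `y` cancel those produced by running `P`
backwards in time; only bounded terms remain. -/
theorem tendsto_slope_domain (hP : IsWeakRiccati A S Q τ P) (hA : IsGenerator A T)
    (ht : t ∈ Ioc 0 τ) (x y : A.domain) :
    Tendsto (fun k : ℝ => k⁻¹ • (inner ℂ (T k y) (P (t - k) (T k x)) - inner ℂ (y : H) (P t x)))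
      (𝓝[>] 0) (𝓝 (inner ℂ (P t y) (S (P t x)) - inner ℂ (y : H) (Q x))) := by
  have hlim : ∀ z : A.domain, Tendsto (fun k => T k (z : H)) (𝓝[>] 0) (𝓝 z) := fun z => by
    have h := ((hA.isC0Semigroup.continuousOn (z : H)) 0 self_mem_Ici).mono Ioi_subset_Ici_self
    simpa [ContinuousWithinAt, hA.isC0Semigroup.map_zero] using h
  have hd := tendsto_slope_of_hasDerivWithinAt_Icc ht (hP.hasDeriv x y t ⟨ht.1.le, ht.2⟩)
  have h := tendsto_slope_inner (R := fun k => P (t - k)) (a := fun k => T k (x : H))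
    (b := fun k => T k (y : H)) (α := fun _ => (x : H)) (β := fun _ => (y : H)) (a₀ := (x : H))
    (fun x => (hP.continuous x).comp (by fun_prop)) (hA.tendsto_apply x) (hA.tendsto_apply y)
    (hlim x) tendsto_const_nhds hd
  have e : inner ℂ (P t y) (S (P t x)) - inner ℂ (y : H) (Q x)
      = inner ℂ (A y) (P (t - 0) x) + inner ℂ (y : H) (P (t - 0) (A x))
        + -(inner ℂ (A y) (P t x) + inner ℂ (y : H) (P t (A x)) - inner ℂ (P t y) (S (P t x))
        + inner ℂ (y : H) (Q x)) := by
    rw [sub_zero]; ring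
  rw [e]
  exact h

/-- Since the limit contains no `A`, it extends from the domain to all vectors. This makes the
energy balance valid along trajectories that leave the domain. -/
theorem tendsto_slope (hP : IsWeakRiccati A S Q τ P) (hA : IsGenerator A T)
    (hT : IsExtendedSemigroup T) (ht : t ∈ Ioc 0 τ) (x y : H) :
    Tendsto (fun k : ℝ => k⁻¹ • (inner ℂ (T k y) (P (t - k) (T k x)) - inner ℂ y (P t x)))
      (𝓝[>] 0) (𝓝 (inner ℂ (P t y) (S (P t x)) - inner ℂ y (Q x))) := by
  obtain ⟨c, hc1, hc⟩ := hT.exists_norm_le t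
  obtain ⟨p, hp0, hp⟩ := exists_norm_le_of_isCompact (A := P) (isCompact_Icc (a := 0) (b := t))
    (fun x => (hP.continuous x).continuousOn)
  set m : ℝ := (p * c) * (‖S‖ * (p * c)) + c * (‖Q‖ * c) with hm
  have hdense := hA.dense_domain hT
  have hcont : ∀ x y : H, Continuous fun r => inner ℂ (T r y) (P (t - r) (T r x)) := fun x y =>
    (hT.continuous_apply y).inner (continuous_family_apply (A := fun r => P (t - r))
      (fun z => (hP.continuous z).comp (by fun_prop)) (hT.continuous_apply x))
  -- The domain is invariant under the semigroup, so the preceding limit gives the right derivative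
  -- of `r ↦ ⟨T r y, P (t - r) T r x⟩` throughout `[0, k)`. The mean value inequality then gives a
  -- bound linear in `k` that involves only `‖x‖` and `‖y‖`.
  have hbd : ∀ k ∈ Ioo 0 t, ∀ x y : A.domain,
      ‖inner ℂ (T k y) (P (t - k) (T k x)) - inner ℂ (y : H) (P t x)‖
        ≤ m * ‖(x : H)‖ * ‖(y : H)‖ * k := by
    intro k hk x y
    have hmv := norm_image_sub_le_of_norm_deriv_right_le_segment (a := 0) (b := k)
      (f := fun r => inner ℂ (T r (y : H)) (P (t - r) (T r (x : H))))
      (f' := fun r => inner ℂ (P (t - r) (T r (y : H))) (S (P (t - r) (T r (x : H))))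
        - inner ℂ (T r (y : H)) (Q (T r (x : H)))) (C := m * ‖(x : H)‖ * ‖(y : H)‖)
      (hcont x y).continuousOn (fun r hr => ?_) (fun r hr => ?_) k ⟨hk.1.le, le_rfl⟩
    · simpa [hT.map_zero] using hmv
    · rw [hasDerivWithinAt_Ici_iff_tendsto]
      obtain ⟨x', hx', -⟩ := hA.exists_semigroup_apply x hr.1
      obtain ⟨y', hy', -⟩ := hA.exists_semigroup_apply y hr.1
      have h := hP.tendsto_slope_domain hA (t := t - r)
        ⟨by linarith [hr.2, hk.2], by linarith [hr.1, ht.2]⟩ x' y'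
      rw [hx', hy'] at h
      refine h.congr' ?_
      filter_upwards [self_mem_nhdsWithin] with l (hl : 0 < l)
      rw [add_comm r l, hT.map_add_apply hl.le hr.1, hT.map_add_apply hl.le hr.1,
        add_comm l r, sub_sub]
    · have hrt : r ≤ t := by linarith [hr.2, hk.2]
      have hx := ContinuousLinearMap.le_of_opNorm_le _ (hc r hrt) (x : H)
      have hy := ContinuousLinearMap.le_of_opNorm_le _ (hc r hrt) (y : H)
      have hpr := hp (t - r) ⟨by linarith, by linarith [hr.1]⟩
      have hPx := (ContinuousLinearMap.le_of_opNorm_le _ hpr (T r x)).trans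
        (mul_le_mul_of_nonneg_left hx hp0)
      have hPy := (ContinuousLinearMap.le_of_opNorm_le _ hpr (T r y)).trans
        (mul_le_mul_of_nonneg_left hy hp0)
      calc _ ≤ _ := norm_sub_le _ _
        _ ≤ (p * (c * ‖(y : H)‖)) * (‖S‖ * (p * (c * ‖(x : H)‖)))
            + c * ‖(y : H)‖ * (‖Q‖ * (c * ‖(x : H)‖)) := by
          refine add_le_add ((norm_inner_le_norm _ _).trans ?_)
            ((norm_inner_le_norm _ _).trans ?_)
          · exact mul_le_mul hPy ((S.le_opNorm _).trans (by gcongr)) (norm_nonneg _)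
              (by positivity)
          · exact mul_le_mul hy ((Q.le_opNorm _).trans (by gcongr)) (norm_nonneg _)
              (by positivity)
        _ = m * ‖(x : H)‖ * ‖(y : H)‖ := by rw [hm]; ring
  let V : ℝ → H →L[ℂ] H := fun k => k⁻¹ • ((T k)† ∘L P (t - k) ∘L T k - P t)
  let G : H →L[ℂ] H := P t ∘L S ∘L P t - Q
  have hG : ∀ x y, inner ℂ y (G x) = inner ℂ (P t y) (S (P t x)) - inner ℂ y (Q x) := by
    intro x y
    rw [hP.inner_comm' ⟨ht.1.le, ht.2⟩]
    simp [G]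
  have hV : ∀ k x y, inner ℂ y (V k x)
      = k⁻¹ • (inner ℂ (T k y) (P (t - k) (T k x)) - inner ℂ y (P t x)) := by
    intro k x y
    simp only [V, smul_apply, sub_apply, ContinuousLinearMap.comp_apply, inner_sub_right,
      ContinuousLinearMap.adjoint_inner_right, ← Complex.coe_smul, inner_smul_right, smul_eq_mul]
  have hVb : ∀ k ∈ Ioo 0 t, ‖V k‖ ≤ m := by
    intro k hk
    have hall : ∀ x y, ‖inner ℂ y (V k x)‖ ≤ m * ‖x‖ * ‖y‖ := by
      intro x y
      have hcl : IsClosed {q : H × H | ‖inner ℂ q.2 (V k q.1)‖ ≤ m * ‖q.1‖ * ‖q.2‖} :=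
        isClosed_le (by fun_prop) (by fun_prop)
      refine hcl.closure_subset_iff.2 ?_ ((hdense.prod hdense) (x, y))
      rintro ⟨z, w⟩ ⟨hz, hw⟩
      have := hbd k hk ⟨z, hz⟩ ⟨w, hw⟩
      simp only [mem_ofPred_eq, hV, norm_smul]
      have hk0 := hk.1
      rw [Real.norm_of_nonneg (by positivity), inv_mul_le_iff₀ hk0]
      exact this.trans_eq (by ring)
    refine ContinuousLinearMap.opNorm_le_bound _ (by positivity) fun x => ?_
    have h1 := hall x (V k x)
    rw [inner_self_eq_norm_sq_to_K] at h1
    rcases eq_or_ne (V k x) 0 with h0 | h0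
    · rw [h0, norm_zero]; positivity
    · have hpos := norm_pos_iff.2 h0
      refine le_of_mul_le_mul_right ?_ hpos
      simpa [← pow_two] using h1
  have hVe : ∀ᶠ k in 𝓝[>] 0, ‖V k‖ ≤ m := by
    filter_upwards [Ioo_mem_nhdsGT ht.1] with k hk using hVb k hk
  -- The uniform bound on `V k` allows passing from the domain to `H` in one argument at a time.
  have step1 : ∀ y ∈ A.domain, ∀ x, Tendsto (fun k => inner ℂ y (V k x)) (𝓝[>] 0)
      (𝓝 (inner ℂ y (G x))) := by
    intro y hy x
    refine tendsto_family_of_dense (A := fun k => innerSL ℂ y ∘L V k) (D := innerSL ℂ y ∘L G)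
      (c := ‖y‖ * m) hdense ?_ ?_ x
    · filter_upwards [hVe] with k hk
      refine (ContinuousLinearMap.opNorm_comp_le _ _).trans ?_
      rw [innerSL_apply_norm]
      gcongr
    · intro x hx
      have := hP.tendsto_slope_domain hA ht ⟨x, hx⟩ ⟨y, hy⟩
      rw [← hG] at this
      refine this.congr fun k => ?_
      exact (hV k x y).symm
  have step2 : Tendsto (fun k => inner ℂ (V k x) y) (𝓝[>] 0) (𝓝 (inner ℂ (G x) y)) := by
    refine tendsto_family_of_dense (A := fun k => innerSL ℂ (V k x)) (D := innerSL ℂ (G x))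
      (c := m * ‖x‖) hdense ?_ ?_ y
    · filter_upwards [hVe] with k hk
      rw [innerSL_apply_norm]
      exact ContinuousLinearMap.le_of_opNorm_le _ hk x
    · intro y hy
      have := (Complex.continuous_conj.tendsto _).comp (step1 y hy x)
      simpa [Function.comp_def, inner_conj_symm] using this
  have := (Complex.continuous_conj.tendsto _).comp step2
  simpa only [Function.comp_def, inner_conj_symm, hV, hG] using this

/-- The energy balance along a trajectory. -/
theorem hasDerivWithinAt_energy (hP : IsWeakRiccati A S Q τ P) (hA : IsGenerator A T)
    (hT : IsExtendedSemigroup T) (ht : t ≤ τ) {x f : ℝ → H} (hx : IsTrajectory T x f t)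
    {s : ℝ} (hs : s ∈ Ico 0 t) :
    HasDerivWithinAt (fun r => inner ℂ (x r) (P (t - r) (x r)))
      (inner ℂ (f s) (P (t - s) (x s)) + inner ℂ (x s) (P (t - s) (f s))
        + (inner ℂ (P (t - s) (x s)) (S (P (t - s) (x s))) - inner ℂ (x s) (Q (x s))))
      (Ici s) s := by
  rw [hasDerivWithinAt_Ici_iff_tendsto]
  have hxs : Tendsto (fun k => x (s + k)) (𝓝[>] 0) (𝓝 (x s)) := by
    have := ((hx.continuous.comp' (by fun_prop : Continuous fun k : ℝ => s + k)).tendsto 0).mono_left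
      (nhdsWithin_le_nhds (s := Ioi 0))
    simpa using this
  have h := tendsto_slope_inner (R := fun k => P (t - s - k)) (a := fun k => x (s + k))
    (b := fun k => x (s + k)) (α := fun k => T k (x s)) (β := fun k => T k (x s))
    (fun x => (hP.continuous x).comp (by fun_prop)) (hx.tendsto s hs) (hx.tendsto s hs) hxs
    (hT.tendsto_zero _) (hP.tendsto_slope hA hT (t := t - s)
      ⟨by linarith [hs.2], by linarith [hs.1]⟩ (x s) (x s))
  simpa only [sub_zero, sub_sub] using h

theorem continuous_energy (hP : IsWeakRiccati A S Q τ P) {x : ℝ → H} (hx : Continuous x) (t : ℝ) :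
    Continuous fun r => inner ℂ (x r) (P (t - r) (x r)) :=
  hx.inner (continuous_family_apply (A := fun r => P (t - r))
    (fun z => (hP.continuous z).comp (by fun_prop)) hx)

end IsWeakRiccati

end Riccati

/-! ### Completion of squares, comparison and the a priori bound. -/

section Control

variable {H U Y : Type*}
  [NormedAddCommGroup H] [InnerProductSpace ℂ H] [CompleteSpace H]
  [NormedAddCommGroup U] [InnerProductSpace ℂ U] [CompleteSpace U]
  [NormedAddCommGroup Y] [InnerProductSpace ℂ Y] [CompleteSpace Y]
  {A : H →ₗ.[ℂ] H} {T P P₁ P₂ : ℝ → H →L[ℂ] H} {τ t : ℝ}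
  {B : U →L[ℂ] H} {C : H →L[ℂ] Y} {K : U →L[ℂ] H}

theorem isPositive_of_re_nonneg {D : H →L[ℂ] H} (hD : IsSelfAdjoint D)
    (h : ∀ x, 0 ≤ RCLike.re (inner ℂ x (D x))) : D.IsPositive := by
  refine ContinuousLinearMap.isPositive_def.2 ⟨hD.isSymmetric, fun x => ?_⟩
  rw [ContinuousLinearMap.reApplyInnerSelf_apply, inner_re_symm]
  exact h x

theorem ContinuousLinearMap.IsPositive.re_nonneg {D : H →L[ℂ] H} (hD : D.IsPositive) (x : H) :
    0 ≤ RCLike.re (inner ℂ x (D x)) := by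
  have := (ContinuousLinearMap.isPositive_def.1 hD).2 x
  rwa [ContinuousLinearMap.reApplyInnerSelf_apply, inner_re_symm] at this

theorem ContinuousLinearMap.IsPositive.norm_le {D : H →L[ℂ] H} (hD : D.IsPositive) {c : ℝ}
    (hc : 0 ≤ c) (h : ∀ x, RCLike.re (inner ℂ x (D x)) ≤ c * ‖x‖ ^ 2) : ‖D‖ ≤ c := by
  rw [ContinuousLinearMap.norm_eq_iSup_rayleighQuotient D hD.isSelfAdjoint.isSymmetric]
  refine ciSup_le fun x => ?_
  have h0 := hD.re_nonneg x
  rw [ContinuousLinearMap.rayleighQuotient, ContinuousLinearMap.reApplyInnerSelf_apply,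
    inner_re_symm, abs_of_nonneg (by positivity)]
  exact div_le_of_le_mul₀ (by positivity) hc (h x)

/-- Coercivity makes `K* K` invertible (Lax–Milgram), so `gramInv` is a genuine inverse and not the
default value `0` of `inverse`. -/
theorem gram_gramInv (hK : IsCoerciveOp K) (v : U) : (K†) (K (gramInv K v)) = v := by
  obtain ⟨m, hm, h⟩ := hK
  have hu : IsUnit (K† ∘L K) := by
    refine ContinuousLinearMap.isUnit_of_forall_le_norm_inner_map _ (c := ⟨m, hm.le⟩) hm
      fun u => ?_
    have h1 := h u
    rw [inner_re_symm] at h1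
    change ‖u‖ ^ 2 * m ≤ _
    rw [mul_comm]
    exact h1.trans (RCLike.re_le_norm _)
  have h2 : (K† ∘L K) * gramInv K = 1 := by
    rw [gramInv, ← ContinuousLinearMap.ringInverse_eq_inverse]
    exact Ring.mul_inverse_cancel _ hu
  exact DFunLike.congr_fun h2 v

theorem inner_gramInv (hK : IsCoerciveOp K) (v w : U) :
    inner ℂ v (gramInv K w) = inner ℂ (K (gramInv K v)) (K (gramInv K w)) := by
  have h := ContinuousLinearMap.adjoint_inner_left K (gramInv K w) (K (gramInv K v))
  rwa [gram_gramInv hK] at h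

theorem inner_gramInv_symm (hK : IsCoerciveOp K) (v w : U) :
    inner ℂ v (gramInv K w) = inner ℂ (gramInv K v) w := by
  rw [inner_gramInv hK, ← ContinuousLinearMap.adjoint_inner_right, gram_gramInv hK]

/-- The algebraic completion of the square: the cross term simplifies because `K* K (K* K)⁻¹ v = v`.
-/
theorem norm_sq_add_gramInv (hK : IsCoerciveOp K) (u v : U) :
    ‖K (u + gramInv K v)‖ ^ 2
      = ‖K u‖ ^ 2 + 2 * RCLike.re (inner ℂ u v) + RCLike.re (inner ℂ v (gramInv K v)) := by
  rw [map_add, norm_add_sq (𝕜 := ℂ), ← ContinuousLinearMap.adjoint_inner_right,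
    gram_gramInv hK, inner_gramInv hK, inner_self_eq_norm_sq]

/-- The quadratic coefficient `B (K* K)⁻¹ B*` of the Riccati equation. -/
noncomputable def riccatiQuad (B : U →L[ℂ] H) (K : U →L[ℂ] H) : H →L[ℂ] H :=
  B ∘L gramInv K ∘L B†

theorem inner_riccatiQuad (x y : H) :
    inner ℂ y (riccatiQuad B K x) = inner ℂ ((B†) y) (gramInv K ((B†) x)) := by
  rw [ContinuousLinearMap.adjoint_inner_left]; rfl

theorem isSelfAdjoint_riccatiQuad (hK : IsCoerciveOp K) : IsSelfAdjoint (riccatiQuad B K) := by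
  rw [ContinuousLinearMap.isSelfAdjoint_iff_isSymmetric]
  intro x y
  change inner ℂ (riccatiQuad B K x) y = inner ℂ x (riccatiQuad B K y)
  rw [inner_riccatiQuad, inner_gramInv_symm hK, ← inner_conj_symm, inner_riccatiQuad,
    inner_conj_symm]

theorem inner_gram (x y : H) : inner ℂ y ((C† ∘L C) x) = inner ℂ (C y) (C x) :=
  ContinuousLinearMap.adjoint_inner_right C y (C x)

theorem IsWeakRiccati.isDRESolution (hP : IsWeakRiccati A (riccatiQuad B K) (C† ∘L C) τ P) :
    IsDRESolution A B C K (P 0) τ P where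
  isSelfAdjoint := hP.isSelfAdjoint
  continuousOn x := (hP.continuous x).continuousOn
  initial := rfl
  hasDeriv x y t ht := by
    simpa only [inner_riccatiQuad, inner_gram] using hP.hasDeriv x y t ht

theorem IsDRESolution.isWeakRiccati {P₀ : H →L[ℂ] H} (hτ : 0 ≤ τ)
    (hP : IsDRESolution A B C K P₀ τ P) :
    IsWeakRiccati A (riccatiQuad B K) (C† ∘L C) τ fun t => P (projIcc 0 τ hτ t) where
  continuous x := by
    have := (continuousOn_iff_continuous_domRestrict.1 (hP.continuousOn x)).comp
      (continuous_projIcc (h := hτ))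
    exact this
  isSelfAdjoint t ht := by simpa [projIcc_of_mem hτ ht] using hP.isSelfAdjoint t ht
  hasDeriv x y t ht := by
    have h := hP.hasDeriv x y t ht
    simp only [inner_riccatiQuad, inner_gram, projIcc_of_mem hτ ht]
    refine h.congr (fun s hs => ?_) ?_
    · simp only [projIcc_of_mem hτ hs]
    · simp only [projIcc_of_mem hτ ht]

/-- As a constant family, a stationary solution falls under the comparison results. -/
theorem IsARESolution.isWeakRiccati {R : H →L[ℂ] H} (hR : IsARESolution A B C K R) (τ : ℝ) :
    IsWeakRiccati A (riccatiQuad B K) (C† ∘L C) τ fun _ => R where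
  continuous x := continuous_const
  isSelfAdjoint _ _ := hR.isSelfAdjoint
  hasDeriv x y t ht := by
    have h := hR.equation x y
    simp only [inner_riccatiQuad, inner_gram, h]
    exact hasDerivWithinAt_const _ _ _

/-- Completion of squares along a controlled trajectory. -/
theorem IsWeakRiccati.hasDerivWithinAt_control
    (hP : IsWeakRiccati A (riccatiQuad B K) (C† ∘L C) τ P) (hK : IsCoerciveOp K)
    (hA : IsGenerator A T) (hT : IsExtendedSemigroup T) (ht : t ≤ τ) {x : ℝ → H} {u : ℝ → U}
    (hx : IsTrajectory T x (fun s => B (u s)) t) {s : ℝ} (hs : s ∈ Ico 0 t) :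
    HasDerivWithinAt (fun r => RCLike.re (inner ℂ (x r) (P (t - r) (x r))))
      (‖K (u s + gramInv K ((B†) (P (t - s) (x s))))‖ ^ 2 - ‖K (u s)‖ ^ 2 - ‖C (x s)‖ ^ 2)
      (Ici s) s := by
  have h := hP.hasDerivWithinAt_energy hA hT ht hx hs
  have h1 := Complex.reCLM.hasFDerivAt.comp_hasDerivWithinAt s h
  have e1 : RCLike.re (inner ℂ (x s) (P (t - s) (B (u s))))
      = RCLike.re (inner ℂ (B (u s)) (P (t - s) (x s))) := by
    rw [← hP.inner_comm' ⟨by linarith [hs.2], by linarith [hs.1]⟩, inner_re_symm]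
  have e2 : inner ℂ (B (u s)) (P (t - s) (x s)) = inner ℂ (u s) ((B†) (P (t - s) (x s))) :=
    (ContinuousLinearMap.adjoint_inner_right _ _ _).symm
  have e3 : RCLike.re (inner ℂ (C (x s)) (C (x s))) = ‖C (x s)‖ ^ 2 := inner_self_eq_norm_sq _
  have e : ‖K (u s + gramInv K ((B†) (P (t - s) (x s))))‖ ^ 2 - ‖K (u s)‖ ^ 2 - ‖C (x s)‖ ^ 2
      = Complex.reCLM (inner ℂ (B (u s)) (P (t - s) (x s)) + inner ℂ (x s) (P (t - s) (B (u s)))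
        + (inner ℂ (P (t - s) (x s)) (riccatiQuad B K (P (t - s) (x s)))
          - inner ℂ (x s) ((C† ∘L C) (x s)))) := by
    rw [norm_sq_add_gramInv hK, inner_gram, inner_riccatiQuad]
    simp only [Complex.reCLM_apply, Complex.add_re, Complex.sub_re]
    simp only [← RCLike.re_eq_complex_re, e1, e2, e3]
    ring
  rw [e]
  exact h1

theorem IsWeakRiccati.continuous_re_energy
    (hP : IsWeakRiccati A (riccatiQuad B K) (C† ∘L C) τ P) {x : ℝ → H} (hx : Continuous x)
    (t : ℝ) : Continuous fun r => RCLike.re (inner ℂ (x r) (P (t - r) (x r))) :=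
  Complex.continuous_re.comp (hP.continuous_energy hx t)

/-- The optimal feedback belonging to the Riccati solution `P` with horizon `t`. -/
noncomputable def optimalControl (B : U →L[ℂ] H) (K : U →L[ℂ] H) (P : ℝ → H →L[ℂ] H) (t : ℝ)
    (x : ℝ → H) (s : ℝ) : U :=
  -gramInv K ((B†) (P (t - s) (x s)))

/-- The optimal control is a time-varying bounded linear feedback of the state, so this is an
instance of `exists_closedLoop`. -/
theorem IsWeakRiccati.exists_optimal (hP : IsWeakRiccati A (riccatiQuad B K) (C† ∘L C) τ P)
    (hT : IsExtendedSemigroup T) (ht : 0 ≤ t) (x₀ : H) :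
    ∃ x : ℝ → H, x 0 = x₀ ∧ IsTrajectory T x (fun s => B (optimalControl B K P t x s)) t := by
  obtain ⟨x, hx0, hx⟩ := exists_closedLoop hT (N := fun s => -(riccatiQuad B K ∘L P (t - s)))
    (fun z => by
      have : Continuous fun s : ℝ => riccatiQuad B K (P (t - s) z) :=
        (riccatiQuad B K).continuous.comp ((hP.continuous z).comp' (by fun_prop))
      exact this.neg) ht x₀
  refine ⟨x, hx0, ?_⟩
  convert hx using 2 with s
  simp [optimalControl, riccatiQuad]

theorem IsWeakRiccati.hasDerivWithinAt_optimal (hA : IsGenerator A T)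
    (hT : IsExtendedSemigroup T) (hK : IsCoerciveOp K)
    (hP : IsWeakRiccati A (riccatiQuad B K) (C† ∘L C) τ P) (ht : t ≤ τ) {x : ℝ → H}
    (hx : IsTrajectory T x (fun s => B (optimalControl B K P t x s)) t) {s : ℝ}
    (hs : s ∈ Ico 0 t) :
    HasDerivWithinAt (fun r => RCLike.re (inner ℂ (x r) (P (t - r) (x r))))
      (-‖K (optimalControl B K P t x s)‖ ^ 2 - ‖C (x s)‖ ^ 2) (Ici s) s := by
  have h := hP.hasDerivWithinAt_control hK hA hT ht hx hs
  rw [optimalControl, neg_add_cancel, map_zero, norm_zero] at h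
  rw [optimalControl]
  simpa using h

/-- Dynamic programming inequality along the optimal trajectory of the first solution. -/
theorem IsWeakRiccati.comparison (hA : IsGenerator A T)
    (hT : IsExtendedSemigroup T) (hK : IsCoerciveOp K)
    (h₁ : IsWeakRiccati A (riccatiQuad B K) (C† ∘L C) τ P₁)
    (h₂ : IsWeakRiccati A (riccatiQuad B K) (C† ∘L C) τ P₂) (ht : t ≤ τ) {x : ℝ → H}
    (hx : IsTrajectory T x (fun s => B (optimalControl B K P₁ t x s)) t) {s : ℝ}
    (hs : s ∈ Icc 0 t) :
    RCLike.re (inner ℂ (x s) ((P₁ (t - s) - P₂ (t - s)) (x s)))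
      ≤ RCLike.re (inner ℂ (x 0) ((P₁ t - P₂ t) (x 0))) := by
  have h := le_of_rightDeriv_nonpos hs.1
    (f := fun r => RCLike.re (inner ℂ (x r) (P₁ (t - r) (x r)))
      - RCLike.re (inner ℂ (x r) (P₂ (t - r) (x r))))
    ((h₁.continuous_re_energy hx.continuous t).sub
      (h₂.continuous_re_energy hx.continuous t)).continuousOn
    (fun r hr => (h₁.hasDerivWithinAt_control hK hA hT ht hx ⟨hr.1, hr.2.trans_le hs.2⟩).sub
      (h₂.hasDerivWithinAt_control hK hA hT ht hx ⟨hr.1, hr.2.trans_le hs.2⟩))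
    -- The control annihilates the square belonging to `P₁`. The costs cancel, and what is left is
    -- minus the square belonging to `P₂`.
    (fun r hr => by
      rw [optimalControl, neg_add_cancel, map_zero, norm_zero]
      have := sq_nonneg ‖K (-gramInv K ((B†) (P₁ (t - r) (x r)))
        + gramInv K ((B†) (P₂ (t - r) (x r))))‖
      linarith)
  simpa [inner_sub_right] using h

/-- The trajectory optimal for the larger solution `P₁` is followed up to `s = t`, where the
comparison meets the initial values. -/
theorem IsWeakRiccati.sub_isPositive (hA : IsGenerator A T)
    (hT : IsExtendedSemigroup T) (hK : IsCoerciveOp K)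
    (h₁ : IsWeakRiccati A (riccatiQuad B K) (C† ∘L C) τ P₁)
    (h₂ : IsWeakRiccati A (riccatiQuad B K) (C† ∘L C) τ P₂)
    (h0 : (P₁ 0 - P₂ 0).IsPositive) (ht : t ∈ Icc 0 τ) : (P₁ t - P₂ t).IsPositive := by
  refine isPositive_of_re_nonneg ((h₁.isSelfAdjoint t ht).sub (h₂.isSelfAdjoint t ht)) fun x₀ => ?_
  obtain ⟨x, rfl, hx⟩ := h₁.exists_optimal hT ht.1 x₀
  have h := h₁.comparison hA hT hK h₂ ht.2 hx (right_mem_Icc.2 ht.1)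
  rw [sub_self] at h
  exact (h0.re_nonneg _).trans h

theorem IsWeakRiccati.eq_of_initial_eq (hA : IsGenerator A T)
    (hT : IsExtendedSemigroup T) (hK : IsCoerciveOp K)
    (h₁ : IsWeakRiccati A (riccatiQuad B K) (C† ∘L C) τ P₁)
    (h₂ : IsWeakRiccati A (riccatiQuad B K) (C† ∘L C) τ P₂)
    (h0 : P₁ 0 = P₂ 0) (ht : t ∈ Icc 0 τ) : P₁ t = P₂ t := by
  have h12 := h₁.sub_isPositive hA hT hK h₂
    (by rw [h0, sub_self]; exact ContinuousLinearMap.isPositive_zero) ht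
  have h21 := h₂.sub_isPositive hA hT hK h₁
    (by rw [h0, sub_self]; exact ContinuousLinearMap.isPositive_zero) ht
  have hn : ‖P₁ t - P₂ t‖ ≤ 0 := by
    refine h12.norm_le le_rfl fun x => ?_
    have := h21.re_nonneg x
    rw [← neg_sub, neg_apply, inner_neg_right, map_neg] at this
    linarith
  exact sub_eq_zero.1 (norm_le_zero_iff.1 hn)

/-- Along an optimal trajectory the energy decreases, and it ends at `⟨P(0)x(t), x(t)⟩ ≥ 0`. -/
theorem IsWeakRiccati.isPositive (hA : IsGenerator A T)
    (hT : IsExtendedSemigroup T) (hK : IsCoerciveOp K)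
    (hP : IsWeakRiccati A (riccatiQuad B K) (C† ∘L C) τ P)
    (h0 : (P 0).IsPositive) (ht : t ∈ Icc 0 τ) : (P t).IsPositive := by
  refine isPositive_of_re_nonneg (hP.isSelfAdjoint t ht) fun x₀ => ?_
  obtain ⟨x, rfl, hx⟩ := hP.exists_optimal hT ht.1 x₀
  have h := le_of_rightDeriv_nonpos ht.1
    (hP.continuous_re_energy hx.continuous t).continuousOn
    (fun r hr => hP.hasDerivWithinAt_optimal hA hT hK ht.2 hx hr)
    (fun r hr => by
      have := sq_nonneg ‖K (optimalControl B K P t x r)‖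
      have := sq_nonneg ‖C (x r)‖
      linarith)
  simp only [sub_self, sub_zero] at h
  exact (h0.re_nonneg _).trans h

/-- Stabilizability bounds the Riccati solution starting from zero uniformly in time. -/
theorem exists_norm_le_of_stabilizable (hA : IsGenerator A T)
    (hT : IsExtendedSemigroup T) (hK : IsCoerciveOp K) (hB : ExpStabilizable A B) (C : H →L[ℂ] Y) :
    ∃ c > (0 : ℝ), ∀ (τ : ℝ) (P : ℝ → H →L[ℂ] H),
      IsWeakRiccati A (riccatiQuad B K) (C† ∘L C) τ P → P 0 = 0 →
        ∀ t ∈ Icc 0 τ, ‖P t‖ ≤ c := by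
  obtain ⟨F, S₀, hS₀, M, hM, w, hw, hdecay₀⟩ := hB
  set S : ℝ → H →L[ℂ] H := fun t => S₀ (max t 0) with hSdef
  have hS : IsGenerator _ S := hS₀.extend
  have hSe : IsExtendedSemigroup S := hS₀.isC0Semigroup.extend
  have hdecay : ∀ t : ℝ, 0 ≤ t → ‖S t‖ ≤ M * Real.exp (-w * t) := fun t ht => by
    simpa [S, max_eq_left ht] using hdecay₀ t ht
  -- The control `u = F x` has running cost at most `a e^{-2ws} ‖x₀‖²`, hence total cost at most `a
  -- / (2w) ‖x₀‖²`. The added `1` below only makes the constant strictly positive.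
  set a : ℝ := (‖K ∘L F‖ * M) ^ 2 + (‖C‖ * M) ^ 2 with ha
  refine ⟨a / (2 * w) + 1, by positivity, fun τ P hP h0 t ht => ?_⟩
  have hpos := hP.isPositive hA hT hK (by rw [h0]; exact ContinuousLinearMap.isPositive_zero) ht
  refine hpos.norm_le (by positivity) fun x₀ => ?_
  have hx : IsTrajectory T (fun s => S s x₀) (fun s => B (F (S s x₀))) t :=
    hSe.isTrajectory (D := B ∘L F) (hA.tendsto_perturbation hT hS hSe) x₀ t
  -- The first term is the bound for the cost still to be paid after time `s`; its decrease
  -- dominates the running cost.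
  have h := le_of_rightDeriv_nonpos ht.1
    (f := fun s => a * ‖x₀‖ ^ 2 / (2 * w) * Real.exp (-(2 * w) * s)
      - RCLike.re (inner ℂ (S s x₀) (P (t - s) (S s x₀))))
    (((by fun_prop : Continuous fun s : ℝ => a * ‖x₀‖ ^ 2 / (2 * w) * Real.exp (-(2 * w) * s)).sub
      (hP.continuous_re_energy hx.continuous t)).continuousOn)
    (fun s hs => by
      have hexp : HasDerivWithinAt
          (fun s : ℝ => a * ‖x₀‖ ^ 2 / (2 * w) * Real.exp (-(2 * w) * s))
          (-(a * ‖x₀‖ ^ 2 * Real.exp (-(2 * w) * s))) (Ici s) s := by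
        have h1 := (((hasDerivAt_id s).const_mul (-(2 * w))).exp.const_mul
          (a * ‖x₀‖ ^ 2 / (2 * w))).hasDerivWithinAt (s := Ici s)
        simp only [id] at h1
        have e : a * ‖x₀‖ ^ 2 / (2 * w) * (Real.exp (-(2 * w) * s) * (-(2 * w) * 1))
            = -(a * ‖x₀‖ ^ 2 * Real.exp (-(2 * w) * s)) := by field_simp
        rw [e] at h1
        exact h1
      exact hexp.sub (hP.hasDerivWithinAt_control hK hA hT ht.2 hx hs))
    (fun s hs => by
      have hs0 := hdecay s hs.1
      have hxs : ‖S s x₀‖ ≤ M * Real.exp (-w * s) * ‖x₀‖ :=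
        ContinuousLinearMap.le_of_opNorm_le _ hs0 x₀
      have e : Real.exp (-(2 * w) * s) = Real.exp (-w * s) ^ 2 := by
        rw [← Real.exp_nat_mul]; congr 1; push_cast; ring
      have h1 : ‖K (F (S s x₀))‖ ^ 2 ≤ (‖K ∘L F‖ * (M * Real.exp (-w * s) * ‖x₀‖)) ^ 2 := by
        gcongr
        exact ((K ∘L F).le_opNorm _).trans (by gcongr)
      have h2 : ‖C (S s x₀)‖ ^ 2 ≤ (‖C‖ * (M * Real.exp (-w * s) * ‖x₀‖)) ^ 2 := by
        gcongr
        exact (C.le_opNorm _).trans (by gcongr)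
      have h3 := sq_nonneg ‖K (F (S s x₀) + gramInv K ((B†) (P (t - s) (S s x₀))))‖
      have h4 : a * ‖x₀‖ ^ 2 * Real.exp (-w * s) ^ 2
          = (‖K ∘L F‖ * (M * Real.exp (-w * s) * ‖x₀‖)) ^ 2
            + (‖C‖ * (M * Real.exp (-w * s) * ‖x₀‖)) ^ 2 := by rw [ha]; ring
      rw [e, h4]
      linarith)
  have hS0 : S 0 = 1 := hSe.map_zero
  simp only [sub_self, h0, hS0, sub_zero, mul_zero, Real.exp_zero, mul_one,
    zero_apply, inner_zero_right, map_zero, one_apply_eq_self] at h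
  have h5 : 0 ≤ a * ‖x₀‖ ^ 2 / (2 * w) * Real.exp (-(2 * w) * t) := by positivity
  have h6 : (a / (2 * w) + 1) * ‖x₀‖ ^ 2 = a * ‖x₀‖ ^ 2 / (2 * w) + ‖x₀‖ ^ 2 := by ring
  have h7 := sq_nonneg ‖x₀‖
  rw [h6]
  linarith

end Control

/-! ### Gluing of solutions and the mild Riccati equation. -/

section Existence

variable {H : Type*} [NormedAddCommGroup H] [InnerProductSpace ℂ H] [CompleteSpace H]
  {A : H →ₗ.[ℂ] H} {S Q P₀ : H →L[ℂ] H} {T P P' : ℝ → H →L[ℂ] H} {τ t : ℝ}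

/-- The prescribed right derivative is continuous in time, so the function is an integral of it and
is differentiable from both sides. -/
theorem IsWeakRiccati.of_rightDeriv (hc : ∀ x, Continuous fun t => P t x)
    (hsa : ∀ t ∈ Icc 0 τ, IsSelfAdjoint (P t))
    (hd : ∀ x y : A.domain, ∀ t ∈ Ico 0 τ, HasDerivWithinAt (fun s => inner ℂ (y : H) (P s x))
      (inner ℂ (A y) (P t x) + inner ℂ (y : H) (P t (A x)) - inner ℂ (P t y) (S (P t x))
        + inner ℂ (y : H) (Q x)) (Ici t) t) : IsWeakRiccati A S Q τ P where
  continuous := hc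
  isSelfAdjoint := hsa
  hasDeriv x y t ht := by
    set φ : ℝ → ℂ := fun t => inner ℂ (A y) (P t x) + inner ℂ (y : H) (P t (A x))
      - inner ℂ (P t y) (S (P t x)) + inner ℂ (y : H) (Q x) with hφ
    have hφc : Continuous φ := by
      have h1 := hc x
      have h2 := hc (A x)
      have h3 := hc y
      exact (((continuous_const.inner h1).add (continuous_const.inner h2)).sub
        (h3.inner (S.continuous.comp h1))).add continuous_const
    have hint : ∀ s ∈ Icc 0 τ, inner ℂ (y : H) (P s x)
        = inner ℂ (y : H) (P 0 x) + ∫ r in (0 : ℝ)..s, φ r := by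
      intro s hs
      rw [intervalIntegral.integral_eq_sub_of_hasDeriv_right
        (f := fun s => inner ℂ (y : H) (P s x))
        (continuous_const.inner (hc x)).continuousOn ?_ (hφc.intervalIntegrable _ _)]
      · ring
      · intro r hr
        rw [min_eq_left hs.1, max_eq_right hs.1] at hr
        exact (hd x y r ⟨hr.1.le, hr.2.trans_le hs.2⟩).mono Ioi_subset_Ici_self
    have hF : HasDerivAt (fun s => inner ℂ (y : H) (P 0 x) + ∫ r in (0 : ℝ)..s, φ r) (φ t) t :=
      (hφc.integral_hasStrictDerivAt 0 t).hasDerivAt.const_add _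
    exact hF.hasDerivWithinAt.congr hint (hint t ht)

theorem IsWeakRiccati.hasDerivWithinAt_right (hP : IsWeakRiccati A S Q τ P) (x y : A.domain)
    (ht : t ∈ Ico 0 τ) : HasDerivWithinAt (fun s => inner ℂ (y : H) (P s x))
      (inner ℂ (A y) (P t x) + inner ℂ (y : H) (P t (A x)) - inner ℂ (P t y) (S (P t x))
        + inner ℂ (y : H) (Q x)) (Ici t) t :=
  (hP.hasDeriv x y t ⟨ht.1, ht.2.le⟩).mono_of_mem_nhdsWithin (Icc_mem_nhdsGE_of_mem ht)

theorem IsWeakRiccati.shift {a : ℝ} (hP : IsWeakRiccati A S Q (τ + a) P) (ha : 0 ≤ a) :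
    IsWeakRiccati A S Q τ fun t => P (t + a) where
  continuous x := (hP.continuous x).comp' (by fun_prop)
  isSelfAdjoint t ht := hP.isSelfAdjoint _ ⟨by linarith [ht.1], by linarith [ht.2]⟩
  hasDeriv x y t ht := by
    have h := hP.hasDeriv x y (t + a) ⟨by linarith [ht.1], by linarith [ht.2]⟩
    have h1 : HasDerivWithinAt (fun t => t + a) 1 (Icc 0 τ) t :=
      ((hasDerivAt_id t).add_const a).hasDerivWithinAt
    have hmaps : MapsTo (fun t => t + a) (Icc 0 τ) (Icc 0 (τ + a)) :=
      fun s hs => ⟨by linarith [hs.1], by linarith [hs.2]⟩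
    have := HasDerivWithinAt.scomp (h := fun t => t + a) t h h1 hmaps
    rw [one_smul] at this
    exact this

theorem IsWeakRiccati.mono {σ : ℝ} (hP : IsWeakRiccati A S Q τ P) (h : σ ≤ τ) :
    IsWeakRiccati A S Q σ P where
  continuous := hP.continuous
  isSelfAdjoint t ht := hP.isSelfAdjoint t (Icc_subset_Icc_right h ht)
  hasDeriv x y t ht :=
    (hP.hasDeriv x y t (Icc_subset_Icc_right h ht)).mono (Icc_subset_Icc_right h)

/-- The equation is autonomous, and right derivatives suffice, so at the junction only the values
have to match. -/
theorem IsWeakRiccati.glue {σ : ℝ} (hP : IsWeakRiccati A S Q τ P) (hP' : IsWeakRiccati A S Q σ P')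
    (h0 : P' 0 = P τ) :
    IsWeakRiccati A S Q (τ + σ) fun t => if t ≤ τ then P t else P' (t - τ) := by
  have hge : ∀ t, τ ≤ t → (if t ≤ τ then P t else P' (t - τ)) = P' (t - τ) := by
    intro t ht
    split_ifs with h
    · rw [le_antisymm h ht, sub_self, h0]
    · rfl
  refine .of_rightDeriv (fun x => ?_) (fun t ht => ?_) (fun x y t ht => ?_)
  · have : (fun t => (if t ≤ τ then P t else P' (t - τ)) x)
        = fun t => if t ≤ τ then P t x else P' (t - τ) x := by
      ext t; split_ifs <;> rfl
    rw [this]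
    refine Continuous.if_le (hP.continuous x) ((hP'.continuous x).comp' (by fun_prop))
      continuous_id continuous_const fun t ht => ?_
    rw [ht, sub_self, h0]
  · split_ifs with h
    · exact hP.isSelfAdjoint t ⟨ht.1, h⟩
    · exact hP'.isSelfAdjoint _ ⟨by linarith, by linarith [ht.2]⟩
  · rcases lt_or_ge t τ with h | h
    · have hd := hP.hasDerivWithinAt_right x y ⟨ht.1, h⟩
      simp only [if_pos h.le]
      refine hd.congr_of_eventuallyEq ?_ (by simp only [if_pos h.le])
      filter_upwards [nhdsWithin_le_nhds (Iio_mem_nhds h)] with s (hs : s < τ)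
      simp only [if_pos hs.le]
    · have hd := hP'.hasDerivWithinAt_right x y (t := t - τ)
        ⟨by linarith, by linarith [ht.2]⟩
      have h1 : HasDerivWithinAt (fun t => t - τ) 1 (Ici t) t :=
        ((hasDerivAt_id t).sub_const τ).hasDerivWithinAt
      have hmaps : MapsTo (fun t => t - τ) (Ici t) (Ici (t - τ)) :=
        fun s hs => sub_le_sub_right (mem_Ici.1 hs) τ
      have hc := HasDerivWithinAt.scomp (h := fun t => t - τ) t hd h1 hmaps
      rw [one_smul] at hc
      simp only [hge t h]
      refine hc.congr (fun s hs => ?_) (by simp only [hge t h, Function.comp])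
      simp only [hge s (h.trans hs), Function.comp]

/-- The integrand of the mild form of the Riccati equation. -/
noncomputable def mildIntegrand (T P : ℝ → H →L[ℂ] H) (S Q : H →L[ℂ] H) (x : H) (s r : ℝ) : H :=
  ((T (s - r))†) (Q (T (s - r) x) - P r (S (P r (T (s - r) x))))

theorem continuous_mildIntegrand (hT : IsExtendedSemigroup T) (hP : ∀ x, Continuous fun t => P t x)
    (x : H) : Continuous (Function.uncurry (mildIntegrand T P S Q x)) := by
  have h1 : Continuous fun p : ℝ × ℝ => T (p.1 - p.2) x :=
    (hT.continuous_apply x).comp' (by fun_prop)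
  have hP2 : ∀ {f : ℝ × ℝ → H}, Continuous f → Continuous fun p : ℝ × ℝ => P p.2 (f p) :=
    fun hf => continuous_family_apply (A := fun p : ℝ × ℝ => P p.2)
      (fun x => (hP x).comp continuous_snd) hf
  exact hT.adjoint.continuous_comp (by fun_prop)
    ((Q.continuous.comp h1).sub (hP2 (S.continuous.comp (hP2 h1))))

theorem intervalIntegrable_mildIntegrand (hT : IsExtendedSemigroup T)
    (hP : ∀ x, Continuous fun t => P t x) (x : H) (s a b : ℝ) :
    IntervalIntegrable (mildIntegrand T P S Q x s) MeasureTheory.volume a b :=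
  ((continuous_mildIntegrand hT hP x).comp
    (by fun_prop : Continuous fun r : ℝ => (s, r))).intervalIntegrable a b

theorem norm_mildIntegrand_le {M p s r : ℝ} (hT : ‖T (s - r)‖ ≤ M) (hP : ‖P r‖ ≤ p) (x : H) :
    ‖mildIntegrand T P S Q x s r‖ ≤ M ^ 2 * (‖Q‖ + p ^ 2 * ‖S‖) * ‖x‖ := by
  have hM0 := (norm_nonneg _).trans hT
  have hp0 := (norm_nonneg _).trans hP
  have hx := ContinuousLinearMap.le_of_opNorm_le _ hT x
  set z := T (s - r) x with hz
  have hPz := ContinuousLinearMap.le_of_opNorm_le _ hP z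
  have h1 : ‖Q z - P r (S (P r z))‖ ≤ ‖Q‖ * (M * ‖x‖) + p * (‖S‖ * (p * (M * ‖x‖))) := by
    refine (norm_sub_le _ _).trans (add_le_add ((Q.le_opNorm _).trans (by gcongr)) ?_)
    refine (ContinuousLinearMap.le_of_opNorm_le _ hP _).trans ?_
    gcongr
    refine (S.le_opNorm _).trans ?_
    gcongr
    exact hPz.trans (by gcongr)
  have hT' : ‖(T (s - r))†‖ ≤ M := by rwa [LinearIsometryEquiv.norm_map]
  refine (ContinuousLinearMap.le_of_opNorm_le _ hT' _).trans ?_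
  calc _ ≤ M * (‖Q‖ * (M * ‖x‖) + p * (‖S‖ * (p * (M * ‖x‖)))) := by gcongr
    _ = _ := by ring

theorem norm_mildIntegrand_sub_le {M p d s r : ℝ} (hT : ‖T (s - r)‖ ≤ M) (hP : ‖P r‖ ≤ p)
    (hP' : ‖P' r‖ ≤ p) (hd : ‖P r - P' r‖ ≤ d) (x : H) :
    ‖mildIntegrand T P S Q x s r - mildIntegrand T P' S Q x s r‖
      ≤ M ^ 2 * (2 * p * ‖S‖) * d * ‖x‖ := by
  have hM0 := (norm_nonneg _).trans hT
  have hp0 := (norm_nonneg _).trans hP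
  have hd0 := (norm_nonneg _).trans hd
  have hx := ContinuousLinearMap.le_of_opNorm_le _ hT x
  set z := T (s - r) x with hz
  -- The splitting `P S P - P' S P' = P S (P - P') + (P - P') S P'` is the source of the factor `2 p
  -- ‖S‖`.
  have e : mildIntegrand T P S Q x s r - mildIntegrand T P' S Q x s r
      = -((T (s - r))†) (P r (S ((P r - P' r) z)) + (P r - P' r) (S (P' r z))) := by
    rw [mildIntegrand, mildIntegrand, ← hz, ← map_sub, ← map_neg]
    congr 1
    simp only [sub_apply, map_sub]
    abel
  rw [e, norm_neg]
  have hT' : ‖(T (s - r))†‖ ≤ M := by rwa [LinearIsometryEquiv.norm_map]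
  refine (ContinuousLinearMap.le_of_opNorm_le _ hT' _).trans ?_
  have h1 : ‖P r (S ((P r - P' r) z))‖ ≤ p * (‖S‖ * (d * (M * ‖x‖))) := by
    refine (ContinuousLinearMap.le_of_opNorm_le _ hP _).trans ?_
    gcongr
    refine (S.le_opNorm _).trans ?_
    gcongr
    exact (ContinuousLinearMap.le_of_opNorm_le _ hd _).trans (by gcongr)
  have h2 : ‖(P r - P' r) (S (P' r z))‖ ≤ d * (‖S‖ * (p * (M * ‖x‖))) := by
    refine (ContinuousLinearMap.le_of_opNorm_le _ hd _).trans ?_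
    gcongr
    refine (S.le_opNorm _).trans ?_
    gcongr
    exact (ContinuousLinearMap.le_of_opNorm_le _ hP' _).trans (by gcongr)
  calc _ ≤ M * (p * (‖S‖ * (d * (M * ‖x‖))) + d * (‖S‖ * (p * (M * ‖x‖)))) := by
        gcongr
        exact (norm_add_le _ _).trans (add_le_add h1 h2)
    _ = _ := by ring

/-- Mild solutions of the Riccati equation are weak solutions. -/
theorem IsWeakRiccati.of_mild (hA : IsGenerator A T) (hT : IsExtendedSemigroup T)
    (hc : ∀ x, Continuous fun t => P t x) (hsa : ∀ t ∈ Icc 0 τ, IsSelfAdjoint (P t))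
    (hmild : ∀ t ∈ Icc 0 τ, ∀ x, P t x
      = ((T t)†) (P 0 (T t x)) + ∫ r in (0 : ℝ)..t, mildIntegrand T P S Q x t r) :
    IsWeakRiccati A S Q τ P := by
  refine .of_rightDeriv hc hsa fun x y t ht => ?_
  rw [hasDerivWithinAt_Ici_iff_tendsto]
  have hii := intervalIntegrable_mildIntegrand (S := S) (Q := Q) hT hc
  -- The mild equation is restarted at time `t`. As `k → 0`, the conjugated term yields the two
  -- terms with `A`, and the average of the integral yields `Q x - P S P x`.
  have hstep : ∀ k, 0 ≤ k → t + k ≤ τ → P (t + k) x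
      = ((T k)†) (P t (T k x)) + ∫ r in (0 : ℝ)..k, mildIntegrand T P S Q x (t + k) (t + r) := by
    intro k hk hkt
    have e1 : ((T k)†) (∫ r in (0 : ℝ)..t, mildIntegrand T P S Q (T k x) t r)
        = ∫ r in (0 : ℝ)..t, mildIntegrand T P S Q x (t + k) r := by
      rw [← ContinuousLinearMap.intervalIntegral_comp_comm _ (hii _ _ _ _)]
      refine intervalIntegral.integral_congr fun r hr => ?_
      rw [uIcc_of_le ht.1] at hr
      have e : T (t + k - r) = T (t - r) * T k := by
        rw [← hT.map_add _ _ (by linarith [hr.2]) hk]; congr 1; ring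
      simp only [mildIntegrand, e]
      change _ = ((T (t - r) ∘L T k)†) _
      rw [ContinuousLinearMap.adjoint_comp]
      rfl
    have e2 : ∫ r in (0 : ℝ)..k, mildIntegrand T P S Q x (t + k) (t + r)
        = ∫ r in t..(t + k), mildIntegrand T P S Q x (t + k) r := by
      have := intervalIntegral.integral_comp_add_left (a := 0) (b := k)
        (mildIntegrand T P S Q x (t + k)) t
      rwa [add_zero] at this
    have e3 : ((T (t + k))†) (P 0 (T (t + k) x)) = ((T k)†) (((T t)†) (P 0 (T t (T k x)))) := by
      rw [hT.map_add t k ht.1 hk]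
      change ((T t ∘L T k)†) _ = _
      rw [ContinuousLinearMap.adjoint_comp]
      rfl
    rw [hmild (t + k) ⟨by linarith [ht.1], hkt⟩, hmild t ⟨ht.1, ht.2.le⟩ (T k x), map_add, e1, e2,
      e3, ← intervalIntegral.integral_add_adjacent_intervals (hii x (t + k) 0 t)
        (hii x (t + k) t (t + k)), add_assoc]
  have hzero : Tendsto (fun k : ℝ => k⁻¹ • (inner ℂ (y : H) (P t x) - inner ℂ (y : H) (P t x)))
      (𝓝[>] 0) (𝓝 0) := by simp
  have hlin := tendsto_slope_inner (R := fun _ => P t) (a := fun k => T k (x : H))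
    (b := fun k => T k (y : H)) (α := fun _ => (x : H)) (β := fun _ => (y : H)) (a₀ := (x : H))
    (e := inner ℂ (y : H) (P t x)) (d := 0)
    (fun x => continuous_const) (hA.tendsto_apply x) (hA.tendsto_apply y)
    (hT.tendsto_zero _) tendsto_const_nhds hzero
  have hav := tendsto_average_integral_add
    (continuous_mildIntegrand (S := S) (Q := Q) hT hc (x : H)) t
  have hin : Tendsto (innerSL ℂ (y : H)) (𝓝 (mildIntegrand T P S Q x t t))
      (𝓝 (innerSL ℂ (y : H) (mildIntegrand T P S Q x t t))) :=
    (innerSL ℂ (y : H)).continuous.tendsto _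
  have hav' := hin.comp hav
  have hsum := hlin.add hav'
  have e : inner ℂ (A y) (P t x) + inner ℂ (y : H) (P t (A x)) + 0
      + innerSL ℂ (y : H) (mildIntegrand T P S Q x t t)
      = inner ℂ (A y) (P t x) + inner ℂ (y : H) (P t (A x)) - inner ℂ (P t y) (S (P t x))
        + inner ℂ (y : H) (Q x) := by
    have hs : inner ℂ (P t y) (S (P t x)) = inner ℂ (y : H) (P t (S (P t x))) :=
      (hsa t ⟨ht.1, ht.2.le⟩).isSymmetric _ _
    have hz : mildIntegrand T P S Q x t t = Q x - P t (S (P t x)) := by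
      have h1 : (T 0)† = 1 := hT.adjoint.map_zero
      rw [mildIntegrand, sub_self, h1, hT.map_zero]
      rfl
    rw [hz, hs, innerSL_apply_apply, inner_sub_right]
    ring
  rw [e] at hsum
  refine hsum.congr' ?_
  filter_upwards [Ioo_mem_nhdsGT (sub_pos.2 ht.2)] with k hk
  rw [hstep k hk.1.le (by linarith [hk.2]), inner_add_right,
    ContinuousLinearMap.adjoint_inner_right]
  simp only [Function.comp, ContinuousLinearMap.map_smul_of_tower, innerSL_apply_apply]
  rw [← smul_add]
  congr 1
  ring

end Existence

/-! ### Local existence by a contraction on strongly continuous families. -/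

section LocalExistence

open scoped BoundedContinuousFunction

variable {H : Type*} [NormedAddCommGroup H] [InnerProductSpace ℂ H] [CompleteSpace H]
  {A : H →ₗ.[ℂ] H} {S Q P₀ : H →L[ℂ] H} {T : ℝ → H →L[ℂ] H} {δ : ℝ}

/-- Strongly continuous operator families on `[0, δ]`, read as operators into the continuous functions `[0, δ] → H` and
extended to the real line by their boundary values. -/
noncomputable def familyEval (hδ : 0 ≤ δ) (X : H →L[ℂ] (Icc 0 δ →ᵇ H)) (s : ℝ) : H →L[ℂ] H :=
  BoundedContinuousFunction.evalCLM ℂ (projIcc 0 δ hδ s) ∘L X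

theorem familyEval_apply (hδ : 0 ≤ δ) (X : H →L[ℂ] (Icc 0 δ →ᵇ H)) (s : ℝ) (x : H) :
    familyEval hδ X s x = X x (projIcc 0 δ hδ s) := rfl

theorem continuous_familyEval (hδ : 0 ≤ δ) (X : H →L[ℂ] (Icc 0 δ →ᵇ H)) (x : H) :
    Continuous fun s => familyEval hδ X s x :=
  (X x).continuous.comp continuous_projIcc

theorem norm_familyEval_le (hδ : 0 ≤ δ) (X : H →L[ℂ] (Icc 0 δ →ᵇ H)) (s : ℝ) :
    ‖familyEval hδ X s‖ ≤ ‖X‖ := by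
  refine ContinuousLinearMap.opNorm_le_bound _ (norm_nonneg X) fun x => ?_
  rw [familyEval_apply]
  exact ((X x).norm_coe_le_norm _).trans (X.le_opNorm x)

theorem familyEval_sub (hδ : 0 ≤ δ) (X Z : H →L[ℂ] (Icc 0 δ →ᵇ H)) (s : ℝ) :
    familyEval hδ (X - Z) s = familyEval hδ X s - familyEval hδ Z s := rfl

/-- The fixed point map whose fixed points are the mild solutions of the Riccati equation. -/
theorem exists_mildMap (hT : IsExtendedSemigroup T) (S Q P₀ : H →L[ℂ] H) (hδ : 0 ≤ δ) {M : ℝ}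
    (hM : ∀ t ≤ δ, ‖T t‖ ≤ M) :
    ∃ Φ : (H →L[ℂ] (Icc 0 δ →ᵇ H)) → (H →L[ℂ] (Icc 0 δ →ᵇ H)),
      (∀ X x s, Φ X x s = ((T s)†) (P₀ (T s x))
        + ∫ r in (0 : ℝ)..s, mildIntegrand T (familyEval hδ X) S Q x s r) ∧
      ∀ X, ‖Φ X‖ ≤ M ^ 2 * ‖P₀‖ + δ * (M ^ 2 * (‖Q‖ + ‖X‖ ^ 2 * ‖S‖)) := by
  have hM0 : 0 ≤ M := (norm_nonneg _).trans (hM 0 hδ)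
  have hc : ∀ X : H →L[ℂ] (Icc 0 δ →ᵇ H), ∀ x,
      Continuous (Function.uncurry (mildIntegrand T (familyEval hδ X) S Q x)) := fun X x =>
    continuous_mildIntegrand hT (continuous_familyEval hδ X) x
  have hi : ∀ X : H →L[ℂ] (Icc 0 δ →ᵇ H), ∀ x s a b, IntervalIntegrable
      (mildIntegrand T (familyEval hδ X) S Q x s) MeasureTheory.volume a b := fun X x s a b =>
    intervalIntegrable_mildIntegrand hT (continuous_familyEval hδ X) x s a b
  let φ : (H →L[ℂ] (Icc 0 δ →ᵇ H)) → H → (Icc 0 δ →ᵇ H) := fun X x =>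
    .mkOfCompact ⟨fun s => ((T s)†) (P₀ (T s x))
        + ∫ r in (0 : ℝ)..s, mildIntegrand T (familyEval hδ X) S Q x s r, by
      refine Continuous.add ?_ ?_
      · exact hT.adjoint.continuous_comp continuous_subtype_val
          (P₀.continuous.comp ((hT.continuous_apply x).comp continuous_subtype_val))
      · exact (intervalIntegral.continuous_parametric_intervalIntegral_of_continuous (hc X x)
          continuous_id).comp continuous_subtype_val⟩
  have hφ : ∀ X x s, φ X x s = ((T s)†) (P₀ (T s x))
      + ∫ r in (0 : ℝ)..s, mildIntegrand T (familyEval hδ X) S Q x s r := fun _ _ _ => rfl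
  have hb : ∀ X x, ‖φ X x‖ ≤ (M ^ 2 * ‖P₀‖ + δ * (M ^ 2 * (‖Q‖ + ‖X‖ ^ 2 * ‖S‖))) * ‖x‖ := by
    intro X x
    rw [BoundedContinuousFunction.norm_le (by positivity)]
    intro s
    have hTs : ‖(T s)†‖ ≤ M := by rw [LinearIsometryEquiv.norm_map]; exact hM _ s.2.2
    have h1 : ‖((T s)†) (P₀ (T s x))‖ ≤ M * (‖P₀‖ * (M * ‖x‖)) := by
      refine (ContinuousLinearMap.le_of_opNorm_le _ hTs _).trans ?_
      gcongr
      refine (P₀.le_opNorm _).trans ?_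
      gcongr
      exact ContinuousLinearMap.le_of_opNorm_le _ (hM _ s.2.2) x
    have h2 : ‖∫ r in (0 : ℝ)..s, mildIntegrand T (familyEval hδ X) S Q x s r‖
        ≤ M ^ 2 * (‖Q‖ + ‖X‖ ^ 2 * ‖S‖) * ‖x‖ * |(s : ℝ) - 0| := by
      apply intervalIntegral.norm_integral_le_of_norm_le_const
      intro r hr
      rw [uIoc_of_le s.2.1] at hr
      exact norm_mildIntegrand_le (hM _ (by linarith [hr.1, s.2.2])) (norm_familyEval_le hδ X r) x
    rw [sub_zero, abs_of_nonneg s.2.1] at h2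
    have h3 : M ^ 2 * (‖Q‖ + ‖X‖ ^ 2 * ‖S‖) * ‖x‖ * s
        ≤ M ^ 2 * (‖Q‖ + ‖X‖ ^ 2 * ‖S‖) * ‖x‖ * δ := by gcongr; exact s.2.2
    rw [hφ]
    calc _ ≤ _ := norm_add_le _ _
      _ ≤ M * (‖P₀‖ * (M * ‖x‖)) + M ^ 2 * (‖Q‖ + ‖X‖ ^ 2 * ‖S‖) * ‖x‖ * δ :=
        add_le_add h1 (h2.trans h3)
      _ = _ := by ring
  have hmadd : ∀ X x y s, mildIntegrand T (familyEval hδ X) S Q (x + y) s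
      = fun r => mildIntegrand T (familyEval hδ X) S Q x s r
        + mildIntegrand T (familyEval hδ X) S Q y s r := by
    intro X x y s
    ext r
    simp only [mildIntegrand, map_add, map_sub]
    abel
  have hmsmul : ∀ X (a : ℂ) x s, mildIntegrand T (familyEval hδ X) S Q (a • x) s
      = fun r => a • mildIntegrand T (familyEval hδ X) S Q x s r := by
    intro X a x s
    ext r
    simp only [mildIntegrand, map_smul, smul_sub, map_sub]
  refine ⟨fun X => LinearMap.mkContinuous
    { toFun := φ X
      map_add' := fun x y => by
        ext s
        rw [BoundedContinuousFunction.add_apply, hφ, hφ, hφ, hmadd,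
          intervalIntegral.integral_add (hi X x s 0 s) (hi X y s 0 s)]
        simp only [map_add]
        abel
      map_smul' := fun a x => by
        ext s
        rw [RingHom.id_apply, BoundedContinuousFunction.smul_apply, hφ, hφ, hmsmul,
          intervalIntegral.integral_smul]
        simp only [map_smul, smul_add] } _ (hb X), fun X x s => hφ X x s, fun X => ?_⟩
  exact LinearMap.mkContinuous_norm_le _ (by positivity) _

theorem inner_mildIntegrand_symm {P : ℝ → H →L[ℂ] H} (hS : IsSelfAdjoint S) (hQ : IsSelfAdjoint Q)
    {s r : ℝ} (hP : ∀ x y, inner ℂ (P r x) y = inner ℂ x (P r y)) (x y : H) :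
    inner ℂ (mildIntegrand T P S Q x s r) y = inner ℂ x (mildIntegrand T P S Q y s r) := by
  have hS' : ∀ x y, inner ℂ (S x) y = inner ℂ x (S y) := hS.isSymmetric
  have hQ' : ∀ x y, inner ℂ (Q x) y = inner ℂ x (Q y) := hQ.isSymmetric
  rw [mildIntegrand, mildIntegrand, ContinuousLinearMap.adjoint_inner_left,
    ContinuousLinearMap.adjoint_inner_right, inner_sub_left, inner_sub_right, hQ', hP, hS', hP]

/-- Local existence for the Riccati equation, with an existence time depending only on the size of
the initial value. -/
theorem exists_local_riccati (hA : IsGenerator A T) (hT : IsExtendedSemigroup T)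
    (hS : IsSelfAdjoint S) (hQ : IsSelfAdjoint Q) {c : ℝ} (hc : 0 ≤ c) :
    ∃ δ > (0 : ℝ), ∀ P₀ : H →L[ℂ] H, IsSelfAdjoint P₀ → ‖P₀‖ ≤ c →
      ∃ P, IsWeakRiccati A S Q δ P ∧ P 0 = P₀ := by
  obtain ⟨M, hM1, hM⟩ := hT.exists_norm_le 1
  -- `M² c` bounds the contribution of the initial value, and `1` is left for the integral. On the
  -- ball of radius `ρ`, `a` bounds the integrand and `b` is its Lipschitz constant; `δ` is chosen
  -- so that `δ a ≤ 1` and `δ b ≤ 1/2`.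
  set ρ : ℝ := M ^ 2 * c + 1 with hρ
  have hρ0 : 0 < ρ := by positivity
  set a : ℝ := M ^ 2 * (‖Q‖ + ρ ^ 2 * ‖S‖) with ha
  set b : ℝ := M ^ 2 * (2 * ρ * ‖S‖) with hb
  have ha0 : 0 ≤ a := by positivity
  have hb0 : 0 ≤ b := by positivity
  set δ : ℝ := 1 / (1 + a + 2 * b) with hδdef
  have hδ : 0 < δ := by positivity
  have hδ1 : δ ≤ 1 := by rw [hδdef, div_le_one (by positivity)]; linarith
  have hδa : δ * a ≤ 1 := by
    rw [hδdef, one_div, inv_mul_le_iff₀ (by positivity)]; linarith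
  have hδb : δ * b ≤ 1 / 2 := by
    rw [hδdef, one_div, inv_mul_le_iff₀ (by positivity)]; linarith
  have hMδ : ∀ t ≤ δ, ‖T t‖ ≤ M := fun t ht => hM t (ht.trans hδ1)
  refine ⟨δ, hδ, fun P₀ hP₀ hP₀c => ?_⟩
  obtain ⟨Φ, hΦ, hΦn⟩ := exists_mildMap hT S Q P₀ hδ.le hMδ
  have hi : ∀ X : H →L[ℂ] (Icc 0 δ →ᵇ H), ∀ x s u v, IntervalIntegrable
      (mildIntegrand T (familyEval hδ.le X) S Q x s) MeasureTheory.volume u v := fun X x s u v =>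
    intervalIntegrable_mildIntegrand hT (continuous_familyEval hδ.le X) x s u v
  -- Symmetry is built into the invariant closed set, so the fixed point is self-adjoint at every
  -- time.
  let D : Set (H →L[ℂ] (Icc 0 δ →ᵇ H)) :=
    {X | ‖X‖ ≤ ρ} ∩ ⋂ (x : H) (y : H) (s : Icc 0 δ), {X | inner ℂ (X x s) y = inner ℂ x (X y s)}
  have hev : ∀ (x : H) (s : Icc 0 δ), Continuous fun X : H →L[ℂ] (Icc 0 δ →ᵇ H) => X x s :=
    fun x s => (BoundedContinuousFunction.evalCLM ℂ s ∘L
      ContinuousLinearMap.apply ℂ (Icc 0 δ →ᵇ H) x).continuous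
  have hD : IsComplete D := by
    refine IsClosed.isComplete (IsClosed.inter (isClosed_le (continuous_norm (E := H →L[ℂ] (Icc 0 δ →ᵇ H))) continuous_const) ?_)
    refine isClosed_iInter fun x => isClosed_iInter fun y => isClosed_iInter fun s => ?_
    exact isClosed_eq ((hev x s).inner continuous_const) (continuous_const.inner (hev y s))
  have hDsymm : ∀ X ∈ D, ∀ r x y, inner ℂ (familyEval hδ.le X r x) y
      = inner ℂ x (familyEval hδ.le X r y) := by
    intro X hX r x y
    exact mem_iInter.1 (mem_iInter.1 (mem_iInter.1 hX.2 x) y) (projIcc 0 δ hδ.le r)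
  have hmaps : MapsTo Φ D D := by
    intro X hX
    refine ⟨?_, mem_iInter.2 fun x => mem_iInter.2 fun y => mem_iInter.2 fun s => ?_⟩
    · have hXρ : ‖X‖ ≤ ρ := hX.1
      calc ‖Φ X‖ ≤ _ := hΦn X
        _ ≤ M ^ 2 * c + δ * a := by rw [ha]; gcongr
        _ ≤ ρ := by rw [hρ]; linarith
    · change inner ℂ (Φ X x s) y = inner ℂ x (Φ X y s)
      rw [hΦ, hΦ, inner_add_left, inner_add_right, ContinuousLinearMap.adjoint_inner_left,
        ContinuousLinearMap.adjoint_inner_right]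
      congr 1
      · exact hP₀.isSymmetric _ _
      · have e1 : ∀ z w : H, inner ℂ z (∫ r in (0 : ℝ)..s,
            mildIntegrand T (familyEval hδ.le X) S Q w s r)
            = ∫ r in (0 : ℝ)..s, inner ℂ z (mildIntegrand T (familyEval hδ.le X) S Q w s r) :=
          fun z w => ((innerSL ℂ z).intervalIntegral_comp_comm (hi X w s 0 s)).symm
        rw [← inner_conj_symm, e1, e1]
        have e2 := Complex.conjCLE.toContinuousLinearMap.intervalIntegral_comp_comm
          (μ := MeasureTheory.volume) (a := 0) (b := s)
          (f := fun r => inner ℂ y (mildIntegrand T (familyEval hδ.le X) S Q x s r))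
          (((innerSL ℂ y).continuous.comp
            ((continuous_mildIntegrand hT (continuous_familyEval hδ.le X) x).comp
              (by fun_prop : Continuous fun r : ℝ => ((s : ℝ), r)))).intervalIntegrable _ _)
        refine e2.symm.trans (intervalIntegral.integral_congr fun r _ => ?_)
        change (starRingEnd ℂ) (inner ℂ y _) = _
        rw [inner_conj_symm]
        exact inner_mildIntegrand_symm hS hQ (hDsymm X hX r) x y
  have hcontr : ContractingWith (1 / 2) (hmaps.restrict Φ D D) := by
    have hL : LipschitzOnWith (1 / 2) Φ D := LipschitzOnWith.of_dist_le_mul fun X hX Z hZ => ?_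
    · exact ⟨by rw [← NNReal.coe_lt_coe]; norm_num, hL.mapsToRestrict hmaps⟩
    rw [dist_eq_norm, dist_eq_norm]
    refine ContinuousLinearMap.opNorm_le_bound _ (by positivity) fun x => ?_
    rw [BoundedContinuousFunction.norm_le (by positivity)]
    intro s
    have e : (Φ X - Φ Z) x s = ∫ r in (0 : ℝ)..s,
        (mildIntegrand T (familyEval hδ.le X) S Q x s r
          - mildIntegrand T (familyEval hδ.le Z) S Q x s r) := by
      rw [intervalIntegral.integral_sub (hi X x s 0 s) (hi Z x s 0 s)]
      change Φ X x s - Φ Z x s = _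
      rw [hΦ, hΦ]
      abel
    have h2 : ‖(Φ X - Φ Z) x s‖ ≤ b * ‖X - Z‖ * ‖x‖ * |(s : ℝ) - 0| := by
      rw [e]
      apply intervalIntegral.norm_integral_le_of_norm_le_const
      intro r hr
      rw [uIoc_of_le s.2.1] at hr
      refine norm_mildIntegrand_sub_le (hMδ _ (by linarith [hr.1, s.2.2]))
        ((norm_familyEval_le _ X r).trans hX.1) ((norm_familyEval_le _ Z r).trans hZ.1) ?_ x
      rw [← familyEval_sub]
      exact norm_familyEval_le _ _ _
    rw [sub_zero, abs_of_nonneg s.2.1] at h2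
    calc _ ≤ _ := h2
      _ ≤ b * ‖X - Z‖ * ‖x‖ * δ := by gcongr; exact s.2.2
      _ = δ * b * (‖X - Z‖ * ‖x‖) := by ring
      _ ≤ 1 / 2 * (‖X - Z‖ * ‖x‖) := by gcongr
      _ = _ := by simp [mul_assoc]
  have h0D : (0 : H →L[ℂ] (Icc 0 δ →ᵇ H)) ∈ D := by
    refine ⟨(norm_zero (E := H →L[ℂ] (Icc 0 δ →ᵇ H))).le.trans hρ0.le, ?_⟩
    simp
  obtain ⟨X, hX, hfix, -⟩ := hcontr.exists_fixedPoint' hD hmaps h0D (edist_ne_top _ _)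
  have hXs : ∀ s ∈ Icc 0 δ, ∀ x, familyEval hδ.le X s x = ((T s)†) (P₀ (T s x))
      + ∫ r in (0 : ℝ)..s, mildIntegrand T (familyEval hδ.le X) S Q x s r := by
    intro s hs x
    rw [familyEval_apply, projIcc_of_mem hδ.le hs]
    nth_rewrite 1 [← hfix.eq]
    exact hΦ X x ⟨s, hs⟩
  have hX0 : familyEval hδ.le X 0 = P₀ := by
    ext x
    have h1 : (T 0)† = 1 := hT.adjoint.map_zero
    rw [hXs 0 ⟨le_rfl, hδ.le⟩ x, h1, hT.map_zero, intervalIntegral.integral_same, add_zero]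
    rfl
  refine ⟨familyEval hδ.le X, .of_mild hA hT (continuous_familyEval hδ.le X) (fun t _ => ?_)
    (fun t ht x => ?_), hX0⟩
  · rw [ContinuousLinearMap.isSelfAdjoint_iff_isSymmetric]
    exact hDsymm X hX t
  · rw [hX0]
    exact hXs t ht x

end LocalExistence

/-! ### Global solution, decay of optimal trajectories and convergence. -/

section Convergence

variable {H U Y : Type*}
  [NormedAddCommGroup H] [InnerProductSpace ℂ H] [CompleteSpace H]
  [NormedAddCommGroup U] [InnerProductSpace ℂ U] [CompleteSpace U]
  [NormedAddCommGroup Y] [InnerProductSpace ℂ Y] [CompleteSpace Y]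
  {A : H →ₗ.[ℂ] H} {T P : ℝ → H →L[ℂ] H} {τ t : ℝ}
  {B : U →L[ℂ] H} {C : H →L[ℂ] Y} {K : U →L[ℂ] H}

/-- The a priori bound `c` does not depend on the horizon, so the same step `δ` can be glued on
repeatedly. -/
theorem exists_riccati_on_Icc (hA : IsGenerator A T) (hT : IsExtendedSemigroup T)
    (hK : IsCoerciveOp K) (hB : ExpStabilizable A B) (C : H →L[ℂ] Y) (τ : ℝ) :
    ∃ P, IsWeakRiccati A (riccatiQuad B K) (C† ∘L C) τ P ∧ P 0 = 0 := by
  have hQ : IsSelfAdjoint (C† ∘L C) := by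
    rw [ContinuousLinearMap.isSelfAdjoint_iff_isSymmetric]
    intro x y
    change inner ℂ ((C†) (C x)) y = inner ℂ x ((C†) (C y))
    rw [ContinuousLinearMap.adjoint_inner_left, ContinuousLinearMap.adjoint_inner_right]
  obtain ⟨c, hc, hbound⟩ := exists_norm_le_of_stabilizable hA hT hK hB C
  obtain ⟨δ, hδ, hloc⟩ := exists_local_riccati hA hT (isSelfAdjoint_riccatiQuad (B := B) hK) hQ
    hc.le
  have hn : ∀ n : ℕ, ∃ P, IsWeakRiccati A (riccatiQuad B K) (C† ∘L C) (n * δ) P ∧ P 0 = 0 := by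
    intro n
    induction n with
    | zero =>
      obtain ⟨P, hP, h0⟩ := hloc 0 (IsSelfAdjoint.zero _) (by simpa using hc.le)
      exact ⟨P, hP.mono (by simpa using hδ.le), h0⟩
    | succ n ih =>
      obtain ⟨P, hP, h0⟩ := ih
      have hmem : n * δ ∈ Icc 0 (n * δ) := ⟨by positivity, le_rfl⟩
      obtain ⟨P', hP', h0'⟩ := hloc (P (n * δ)) (hP.isSelfAdjoint _ hmem) (hbound _ P hP h0 _ hmem)
      have hg := hP.glue hP' h0'
      refine ⟨_, by convert hg using 1; push_cast; ring, ?_⟩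
      rw [if_pos hmem.1, h0]
  obtain ⟨n, hn'⟩ := exists_nat_ge (τ / δ)
  obtain ⟨P, hP, h0⟩ := hn n
  exact ⟨P, hP.mono ((div_le_iff₀ hδ).1 hn'), h0⟩

/-- By uniqueness, solutions on different horizons agree where both are defined, so the diagonal `t
↦ R t t` solves the equation on every interval. -/
theorem exists_global_riccati (hA : IsGenerator A T) (hT : IsExtendedSemigroup T)
    (hK : IsCoerciveOp K) (hB : ExpStabilizable A B) (C : H →L[ℂ] Y) :
    ∃ P, (∀ τ, IsWeakRiccati A (riccatiQuad B K) (C† ∘L C) τ P) ∧ P 0 = 0 := by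
  choose R hR hR0 using exists_riccati_on_Icc hA hT hK hB C
  have heq : ∀ τ t, t ∈ Icc 0 τ → R t t = R τ t := fun τ t ht =>
    (hR t).eq_of_initial_eq hA hT hK ((hR τ).mono ht.2) (by rw [hR0, hR0]) ⟨ht.1, le_rfl⟩
  have heq' : ∀ τ t, 0 ≤ τ → t ≤ τ → R (max t 0) (max t 0) = R τ (max t 0) := fun τ t hτ ht =>
    heq τ _ ⟨le_max_right _ _, max_le ht hτ⟩
  refine ⟨fun t => R (max t 0) (max t 0), fun τ => ⟨fun x => ?_, fun t ht => ?_,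
    fun x y t ht => ?_⟩, by simp [hR0]⟩
  · rw [continuous_iff_continuousAt]
    intro t
    have hc : Continuous fun s => R (max t 0 + 1) (max s 0) x :=
      ((hR (max t 0 + 1)).continuous x).comp' (by fun_prop)
    refine hc.continuousAt.congr ?_
    have hlt : t < max t 0 + 1 := (le_max_left t 0).trans_lt (lt_add_one _)
    filter_upwards [Iio_mem_nhds hlt] with s hs
    rw [heq' (max t 0 + 1) s (by positivity) (le_of_lt hs)]
  · rw [max_eq_left ht.1]
    exact (hR t).isSelfAdjoint t ⟨ht.1, le_rfl⟩
  · have hval : ∀ s ∈ Icc 0 τ, R (max s 0) (max s 0) = R τ s := fun s hs => by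
      rw [max_eq_left hs.1, heq τ s hs]
    have h := (hR τ).hasDeriv x y t ht
    simp only [hval t ht]
    exact h.congr (fun s hs => by rw [hval s hs]) (by rw [hval t ht])

/-- Detectability: optimal trajectories halve their energy at some time before `N`. -/
theorem exists_time_norm_sq_le_half (hA : IsGenerator A T) (hT : IsExtendedSemigroup T)
    (hK : IsCoerciveOp K) (hC : ExpDetectable A C) (B : U →L[ℂ] H) {c : ℝ} (hc : 0 < c) :
    ∃ N > (0 : ℝ), ∀ (t : ℝ) (P : ℝ → H →L[ℂ] H),
      IsWeakRiccati A (riccatiQuad B K) (C† ∘L C) t P → P 0 = 0 → ‖P t‖ ≤ c → N ≤ t →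
      ∀ x, IsTrajectory T x (fun s => B (optimalControl B K P t x s)) t →
        ∃ s ∈ Icc 0 N, ‖x s‖ ^ 2 ≤ ‖x 0‖ ^ 2 / 2 := by
  obtain ⟨L, S₀, hS₀, M, hM, w, hw, hdecay₀⟩ := hC
  obtain ⟨m, hm, hKm⟩ := id hK
  set S : ℝ → H →L[ℂ] H := fun t => S₀ (max t 0) with hSdef
  have hS : IsGenerator _ S := hS₀.extend
  have hSe : IsExtendedSemigroup S := hS₀.isC0Semigroup.extend
  have hdecay : ∀ t : ℝ, 0 ≤ t → ‖S t‖ ≤ M * Real.exp (-w * t) := fun t ht => by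
    simpa [S, max_eq_left ht] using hdecay₀ t ht
  -- `κ` bounds the squared forcing in terms of the running cost; coercivity supplies `‖u‖² ≤ ‖Ku‖²
  -- / m`. `N` exceeds by `1` the longest time for which the decreasing function in `hE` allows the
  -- state to stay large.
  set κ : ℝ := 2 * (‖B‖ ^ 2 / m + ‖L‖ ^ 2) with hκ
  have hκ0 : 0 ≤ κ := by positivity
  set N : ℝ := 2 * M ^ 2 / w * (1 + κ * c / w) + 1 with hN
  refine ⟨N, by positivity, fun t P hP h0 hPc hNt x hx => ?_⟩
  have hN0 : 0 < N := by positivity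
  by_contra! hcon
  have hx0 : 0 < ‖x 0‖ ^ 2 := by
    have := hcon 0 ⟨le_rfl, hN0.le⟩
    linarith
  set u := optimalControl B K P t x with hu
  -- Output injection: `x' = (A + LC)x + g`, where `A + LC` is exponentially stable and `g` is
  -- controlled by the running cost.
  set g : ℝ → H := fun s => B (u s) - L (C (x s)) with hg
  have hxS : IsTrajectory S x g t :=
    hx.perturb (D := L ∘L C) (hA.tendsto_perturbation hT hS hSe)
  have hgc : Continuous g := hxS.continuous_forcing
  have hgn : ∀ s, ‖g s‖ ^ 2 ≤ κ * (‖K (u s)‖ ^ 2 + ‖C (x s)‖ ^ 2) := by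
    intro s
    have h1 : ‖u s‖ ^ 2 ≤ ‖K (u s)‖ ^ 2 / m := by
      rw [le_div_iff₀ hm, mul_comm]
      refine (hKm (u s)).trans_eq ?_
      rw [inner_gram, inner_self_eq_norm_sq]
    have h2 : ‖g s‖ ≤ ‖B‖ * ‖u s‖ + ‖L‖ * ‖C (x s)‖ :=
      (norm_sub_le _ _).trans (add_le_add (B.le_opNorm _) (L.le_opNorm _))
    calc ‖g s‖ ^ 2 ≤ (‖B‖ * ‖u s‖ + ‖L‖ * ‖C (x s)‖) ^ 2 := by gcongr
      _ ≤ 2 * (‖B‖ ^ 2 * ‖u s‖ ^ 2 + ‖L‖ ^ 2 * ‖C (x s)‖ ^ 2) := by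
        nlinarith [sq_nonneg (‖B‖ * ‖u s‖ - ‖L‖ * ‖C (x s)‖)]
      _ ≤ 2 * (‖B‖ ^ 2 * (‖K (u s)‖ ^ 2 / m) + ‖L‖ ^ 2 * ‖C (x s)‖ ^ 2) := by gcongr
      _ ≤ 2 * (‖B‖ ^ 2 * (‖K (u s)‖ ^ 2 / m) + ‖L‖ ^ 2 * ‖C (x s)‖ ^ 2)
          + 2 * (‖B‖ ^ 2 / m * ‖C (x s)‖ ^ 2 + ‖L‖ ^ 2 * ‖K (u s)‖ ^ 2) :=
        le_add_of_nonneg_right (by positivity)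
      _ = κ * (‖K (u s)‖ ^ 2 + ‖C (x s)‖ ^ 2) := by rw [hκ]; ring
  have hγc : Continuous fun r => Real.exp (w * r) * ‖g r‖ := by fun_prop
  -- A scalar majorant with `z' = -w z + ‖g‖` and `‖x‖ ≤ M z`. Unlike `‖x‖`, it is differentiable.
  set z : ℝ → ℝ := fun s =>
    Real.exp (-w * s) * (‖x 0‖ + ∫ r in (0 : ℝ)..s, Real.exp (w * r) * ‖g r‖) with hz
  have hzd : ∀ s, HasDerivAt z (-w * z s + ‖g s‖) s := by
    intro s
    have h1 : HasDerivAt (fun s => ‖x 0‖ + ∫ r in (0 : ℝ)..s, Real.exp (w * r) * ‖g r‖)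
        (Real.exp (w * s) * ‖g s‖) s := (hγc.integral_hasStrictDerivAt 0 s).hasDerivAt.const_add _
    have h2 : HasDerivAt (fun s => Real.exp (-w * s)) (Real.exp (-w * s) * (-w * 1)) s :=
      ((hasDerivAt_id s).const_mul (-w)).exp
    have h3 := h2.mul h1
    have e : Real.exp (-w * s) * Real.exp (w * s) = 1 := by
      rw [← Real.exp_add]; simp
    have e' : Real.exp (-w * s) * (-w * 1)
          * (‖x 0‖ + ∫ r in (0 : ℝ)..s, Real.exp (w * r) * ‖g r‖)
          + Real.exp (-w * s) * (Real.exp (w * s) * ‖g s‖) = -w * z s + ‖g s‖ := by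
      rw [← mul_assoc (Real.exp (-w * s)) (Real.exp (w * s)), e, hz]; ring
    rw [e'] at h3
    exact h3
  have hzc : Continuous z := continuous_iff_continuousAt.2 fun s => (hzd s).continuousAt
  have hxz : ∀ s ∈ Icc 0 t, ‖x s‖ ≤ M * z s := by
    intro s hs
    have h1 : ‖S s (x 0)‖ ≤ M * Real.exp (-w * s) * ‖x 0‖ :=
      ContinuousLinearMap.le_of_opNorm_le _ (hdecay s hs.1) _
    have h2 : ‖∫ r in (0 : ℝ)..s, S (s - r) (g r)‖
        ≤ ∫ r in (0 : ℝ)..s, M * Real.exp (-w * s) * (Real.exp (w * r) * ‖g r‖) := by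
      refine intervalIntegral.norm_integral_le_of_norm_le hs.1
        (Eventually.of_forall fun r hr => ?_) ((continuous_const.mul hγc).intervalIntegrable _ _)
      refine (ContinuousLinearMap.le_of_opNorm_le _ (hdecay (s - r) (by linarith [hr.2])) _).trans_eq
        ?_
      have e : Real.exp (-w * (s - r)) = Real.exp (-w * s) * Real.exp (w * r) := by
        rw [← Real.exp_add]; congr 1; ring
      rw [e]; ring
    rw [intervalIntegral.integral_const_mul] at h2
    rw [hxS.duhamel hSe hs]
    calc _ ≤ _ := norm_add_le _ _
      _ ≤ _ := add_le_add h1 h2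
      _ = M * z s := by rw [hz]; ring
  set η : ℝ := ‖x 0‖ ^ 2 / (2 * M ^ 2) with hη
  have hηz : ∀ s ∈ Icc 0 N, η < z s ^ 2 := by
    intro s hs
    have h1 := hcon s hs
    have h2 : ‖x s‖ ^ 2 ≤ M ^ 2 * z s ^ 2 := by
      rw [← mul_pow]
      gcongr
      exact hxz s ⟨hs.1, hs.2.trans hNt⟩
    rw [hη, div_lt_iff₀ (by positivity)]
    linarith
  -- By Young's inequality `2z‖g‖ ≤ w z² + ‖g‖² / w`; the last term is absorbed by the decay of the
  -- energy, and `w η ≤ w z²` absorbs the linear term. Comparing the ends `0` and `N` contradicts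
  -- the size of `N`.
  have hE := le_of_rightDeriv_nonpos hN0.le
    (f := fun s => z s ^ 2 + κ / w * RCLike.re (inner ℂ (x s) (P (t - s) (x s))) + w * η * s)
    (((hzc.pow 2).add (continuous_const.mul
      (hP.continuous_re_energy hx.continuous t))).add
      (continuous_const.mul continuous_id)).continuousOn
    (fun s hs => by
      have h1 := ((hzd s).pow 2).hasDerivWithinAt (s := Ici s)
      have h2 := (hP.hasDerivWithinAt_optimal hA hT hK le_rfl hx
        ⟨hs.1, hs.2.trans_le hNt⟩).const_mul (κ / w)
      have h3 := ((hasDerivAt_id s).const_mul (w * η)).hasDerivWithinAt (s := Ici s)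
      exact (h1.add h2).add h3)
    (fun s hs => by
      have h1 := hηz s ⟨hs.1, hs.2.le⟩
      have h2 := hgn s
      have h3 : ‖g s‖ ^ 2 / w ≤ κ / w * (‖K (u s)‖ ^ 2 + ‖C (x s)‖ ^ 2) := by
        rw [div_mul_eq_mul_div]; gcongr
      have h4 : 2 * (z s * ‖g s‖) ≤ w * z s ^ 2 + ‖g s‖ ^ 2 / w := by
        have h5 : 0 ≤ (w * z s - ‖g s‖) ^ 2 / w := by positivity
        have h6 : (w * z s - ‖g s‖) ^ 2 / w
            = w * z s ^ 2 - 2 * (z s * ‖g s‖) + ‖g s‖ ^ 2 / w := by field_simp; ring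
        linarith
      have h7 : w * η ≤ w * z s ^ 2 := by gcongr
      rw [← hu]
      norm_num
      nlinarith)
  have hz0 : z 0 = ‖x 0‖ := by simp [hz]
  have hW0 : RCLike.re (inner ℂ (x 0) (P t (x 0))) ≤ c * ‖x 0‖ ^ 2 := by
    calc _ ≤ ‖inner ℂ (x 0) (P t (x 0))‖ := RCLike.re_le_norm _
      _ ≤ ‖x 0‖ * ‖P t (x 0)‖ := norm_inner_le_norm _ _
      _ ≤ ‖x 0‖ * (c * ‖x 0‖) := by gcongr; exact ContinuousLinearMap.le_of_opNorm_le _ hPc _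
      _ = c * ‖x 0‖ ^ 2 := by ring
  have hWN : 0 ≤ RCLike.re (inner ℂ (x N) (P (t - N) (x N))) :=
    (hP.isPositive hA hT hK (by rw [h0]; exact ContinuousLinearMap.isPositive_zero)
      ⟨by linarith, by linarith⟩).re_nonneg _
  simp only [hz0, sub_zero, mul_zero, add_zero] at hE
  have h1 : κ / w * RCLike.re (inner ℂ (x 0) (P t (x 0))) ≤ κ / w * (c * ‖x 0‖ ^ 2) := by gcongr
  have h2 : 0 ≤ κ / w * RCLike.re (inner ℂ (x N) (P (t - N) (x N))) := by positivity
  have h3 : w * η * N = ‖x 0‖ ^ 2 + κ / w * (c * ‖x 0‖ ^ 2) + w * η := by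
    rw [hη, hN]; field_simp
  have h4 : 0 < w * η := by positivity
  have h5 := sq_nonneg (z N)
  linarith

/-- Induction on `n`: comparison moves the difference from `(t, x 0)` to `(t - s, x s)` with `s ≤
N`. There the previous bound applies to a vector of half the squared norm. -/
theorem norm_sub_le_geometric (hA : IsGenerator A T) (hT : IsExtendedSemigroup T)
    (hK : IsCoerciveOp K) (hP : ∀ τ, IsWeakRiccati A (riccatiQuad B K) (C† ∘L C) τ P)
    (h0 : P 0 = 0) {c N : ℝ} (hc : 0 < c) (hbound : ∀ t, 0 ≤ t → ‖P t‖ ≤ c) (hN : 0 < N)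
    (hhalf : ∀ t, N ≤ t → ∀ x, IsTrajectory T x (fun s => B (optimalControl B K P t x s)) t →
        ∃ s ∈ Icc 0 N, ‖x s‖ ^ 2 ≤ ‖x 0‖ ^ 2 / 2) (n : ℕ) :
    ∀ t, n * N ≤ t → ∀ r, 0 ≤ r → ‖P (t + r) - P t‖ ≤ c / 2 ^ n := by
  have hpos : ∀ t, 0 ≤ t → (P t).IsPositive := fun t ht =>
    (hP t).isPositive hA hT hK (by rw [h0]; exact ContinuousLinearMap.isPositive_zero)
      ⟨ht, le_rfl⟩
  have hshift : ∀ r, 0 ≤ r → ∀ t, IsWeakRiccati A (riccatiQuad B K) (C† ∘L C) t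
      fun s => P (s + r) := fun r hr t => (hP (t + r)).shift hr
  have hmono : ∀ t, 0 ≤ t → ∀ r, 0 ≤ r → (P (t + r) - P t).IsPositive := fun t ht r hr =>
    (hshift r hr t).sub_isPositive hA hT hK (hP t)
      (by simpa [h0] using hpos r hr) ⟨ht, le_rfl⟩
  have hre : ∀ (D : H →L[ℂ] H) (d : ℝ), ‖D‖ ≤ d → ∀ x, RCLike.re (inner ℂ x (D x)) ≤ d * ‖x‖ ^ 2 := by
    intro D d hD x
    calc _ ≤ ‖inner ℂ x (D x)‖ := RCLike.re_le_norm _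
      _ ≤ ‖x‖ * ‖D x‖ := norm_inner_le_norm _ _
      _ ≤ ‖x‖ * (d * ‖x‖) := by gcongr; exact ContinuousLinearMap.le_of_opNorm_le _ hD _
      _ = d * ‖x‖ ^ 2 := by ring
  induction n with
  | zero =>
    intro t ht r hr
    rw [Nat.cast_zero, zero_mul] at ht
    refine (hmono t ht r hr).norm_le (by positivity) fun x => ?_
    have h1 := hre _ _ (hbound (t + r) (by linarith)) x
    have h2 := (hpos t ht).re_nonneg x
    rw [sub_apply, inner_sub_right, map_sub, pow_zero, div_one]
    linarith
  | succ n ih =>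
    intro t ht r hr
    push_cast at ht
    have hnN : 0 ≤ n * N := by positivity
    have ht0 : 0 ≤ t := by linarith
    refine (hmono t ht0 r hr).norm_le (by positivity) fun x₀ => ?_
    obtain ⟨x, rfl, hx⟩ := (hP t).exists_optimal hT ht0 x₀
    obtain ⟨s, hs, hsx⟩ := hhalf t (by linarith) x hx
    have hcmp := (hP t).comparison hA hT hK (hshift r hr t) le_rfl hx
      (s := s) ⟨hs.1, by linarith [hs.2]⟩
    have h1 := hre _ _ (ih (t - s) (by linarith [hs.2]) r hr) (x s)
    -- The trajectory is optimal for the smaller solution `P`, so the comparison is negated to bound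
    -- the difference at `x 0` from above.
    rw [← neg_sub (P (t - s + r)), ← neg_sub (P (t + r))] at hcmp
    simp only [neg_apply, inner_neg_right, map_neg] at hcmp
    calc _ ≤ c / 2 ^ n * ‖x s‖ ^ 2 := by linarith
      _ ≤ c / 2 ^ n * (‖x 0‖ ^ 2 / 2) := by gcongr
      _ = c / 2 ^ (n + 1) * ‖x 0‖ ^ 2 := by ring

theorem isPositive_of_tendsto {R : H →L[ℂ] H} (hP : Tendsto P atTop (𝓝 R))
    (h : ∀ t, 0 ≤ t → (P t).IsPositive) : R.IsPositive := by
  have happ : ∀ x, Tendsto (fun t => P t x) atTop (𝓝 (R x)) := fun x =>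
    ((ContinuousLinearMap.apply ℂ H x).continuous.tendsto R).comp hP
  refine isPositive_of_re_nonneg ?_ fun x => ?_
  · rw [ContinuousLinearMap.isSelfAdjoint_iff_isSymmetric]
    intro x y
    refine tendsto_nhds_unique ((happ x).inner (tendsto_const_nhds (x := y)))
      ((tendsto_const_nhds.inner (happ y)).congr' ?_)
    filter_upwards [eventually_ge_atTop 0] with t ht
    exact ((h t ht).isSelfAdjoint.isSymmetric x y).symm
  · have hl := (Complex.continuous_re.tendsto _).comp
      ((tendsto_const_nhds (x := x)).inner (𝕜 := ℂ) (happ x))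
    refine ge_of_tendsto hl ?_
    filter_upwards [eventually_ge_atTop 0] with t ht
    exact (h t ht).re_nonneg x

/-- The norm limit of a Riccati solution solves the algebraic Riccati equation. -/
theorem isARESolution_of_tendsto {R : H →L[ℂ] H}
    (hP : ∀ τ, IsWeakRiccati A (riccatiQuad B K) (C† ∘L C) τ P)
    (hlim : Tendsto P atTop (𝓝 R)) (hR : IsSelfAdjoint R) : IsARESolution A B C K R where
  isSelfAdjoint := hR
  equation x y := by
    have happ : ∀ x, Tendsto (fun t => P t x) atTop (𝓝 (R x)) := fun x =>
      ((ContinuousLinearMap.apply ℂ H x).continuous.tendsto R).comp hlim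
    set ψ : ℝ → ℂ := fun t => inner ℂ (A y) (P t x) + inner ℂ (y : H) (P t (A x))
      - inner ℂ (P t y) (riccatiQuad B K (P t x)) + inner ℂ (y : H) ((C† ∘L C) x) with hψ
    have hψlim : Tendsto ψ atTop (𝓝 (inner ℂ (A y) (R x) + inner ℂ (y : H) (R (A x))
      - inner ℂ (R y) (riccatiQuad B K (R x)) + inner ℂ (y : H) ((C† ∘L C) x))) := by
      have h1 := happ x
      have h2 := happ (A x)
      have h3 := happ y
      have h4 := ((riccatiQuad B K).continuous.tendsto (R x)).comp h1
      exact (((tendsto_const_nhds.inner h1).add (tendsto_const_nhds.inner h2)).sub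
        (h3.inner h4)).add tendsto_const_nhds
    rw [← inner_riccatiQuad, ← inner_gram]
    set l : ℂ := inner ℂ (A y) (R x) + inner ℂ (y : H) (R (A x))
      - inner ℂ (R y) (riccatiQuad B K (R x)) + inner ℂ (y : H) ((C† ∘L C) x) with hl
    set φ : ℝ → ℂ := fun t => inner ℂ (y : H) (P t x) with hφ
    have hφlim : Tendsto φ atTop (𝓝 (inner ℂ (y : H) (R x))) :=
      tendsto_const_nhds.inner (happ x)
    have hdiff : Tendsto (fun t => φ (t + 1) - φ t) atTop (𝓝 0) := by
      have := (hφlim.comp (tendsto_atTop_add_const_right atTop 1 tendsto_id)).sub hφlim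
      simpa using this
    have hφc : Continuous φ := continuous_const.inner ((hP 0).continuous x)
    -- Unit increments of `φ` tend to the limit `l` of its derivative, and also to `0` because `φ`
    -- converges; hence `l = 0`.
    have hmain : Tendsto (fun t => φ (t + 1) - φ t) atTop (𝓝 l) := by
      rw [Metric.tendsto_nhds]
      intro ε hε
      obtain ⟨a, ha⟩ := eventually_atTop.1 (Metric.tendsto_nhds.1 hψlim (ε / 2) (by positivity))
      filter_upwards [eventually_ge_atTop (max a 0)] with t ht
      have ht0 : 0 ≤ t := (le_max_right _ _).trans ht
      have hta : a ≤ t := (le_max_left _ _).trans ht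
      have hmv := norm_image_sub_le_of_norm_deriv_right_le_segment (a := t) (b := t + 1)
        (f := fun s => φ s - s • l) (f' := fun s => ψ s - (1 : ℝ) • l) (C := ε / 2)
        (by fun_prop)
        (fun s hs => ((hP (t + 1)).hasDerivWithinAt_right x y ⟨ht0.trans hs.1, hs.2⟩).sub
          ((hasDerivAt_id s).smul_const l).hasDerivWithinAt)
        (fun s hs => by
          rw [one_smul, ← dist_eq_norm]
          exact (ha s (hta.trans hs.1)).le) (t + 1) ⟨by linarith, le_rfl⟩
      have e : φ (t + 1) - (t + 1) • l - (φ t - t • l) = φ (t + 1) - φ t - l := by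
        rw [add_smul, one_smul]; abel
      rw [e, add_sub_cancel_left, mul_one] at hmv
      rw [dist_eq_norm]
      linarith
    exact tendsto_nhds_unique hmain hdiff

/-- The factor `2` pays for rounding `t / N` down to an integer. -/
theorem div_two_pow_le_exp {c N t : ℝ} (hc : 0 < c) :
    c / 2 ^ ⌊t / N⌋₊ ≤ 2 * c * Real.exp (-(Real.log 2 / N) * t) := by
  have hlog : 0 < Real.log 2 := Real.log_pos (by norm_num)
  have h1 : t / N < ⌊t / N⌋₊ + 1 := Nat.lt_floor_add_one _
  have h2 : (2 : ℝ) ^ ⌊t / N⌋₊ = Real.exp (⌊t / N⌋₊ * Real.log 2) := by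
    rw [Real.exp_nat_mul, Real.exp_log (by norm_num)]
  have h3 : (2 : ℝ) = Real.exp (Real.log 2) := (Real.exp_log (by norm_num)).symm
  have h4 : 2 * c * Real.exp (-(Real.log 2 / N) * t)
      = c * Real.exp (Real.log 2 + -(Real.log 2 / N) * t) := by
    rw [Real.exp_add, ← h3]; ring
  rw [h4, h2, div_eq_mul_inv, ← Real.exp_neg]
  gcongr
  have h5 : Real.log 2 / N * t = Real.log 2 * (t / N) := by ring
  nlinarith

end Convergence

theorem lemma3p3 {H U Y : Type*}
    [NormedAddCommGroup H] [InnerProductSpace ℂ H] [CompleteSpace H]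
    [NormedAddCommGroup U] [InnerProductSpace ℂ U] [CompleteSpace U]
    [NormedAddCommGroup Y] [InnerProductSpace ℂ Y] [CompleteSpace Y]
    (A : H →ₗ.[ℂ] H) (T : ℝ → H →L[ℂ] H) (hA : IsGenerator A T)
    (B : U →L[ℂ] H) (C : H →L[ℂ] Y) (K : U →L[ℂ] H) (hK : IsCoerciveOp K)
    (hB : ExpStabilizable A B) (hC : ExpDetectable A C) :
    ∃ Pmin : H →L[ℂ] H, IsMinNonnegARESolution A B C K Pmin ∧
    ∃ P : ℝ → H →L[ℂ] H,
      -- `P` is the solution of the differential Riccati equation with `P 0 = 0`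
      (∀ τ : ℝ, 0 < τ → IsDRESolution A B C K 0 τ P) ∧
      (∀ t : ℝ, 0 ≤ t → (P t).IsPositive) ∧
      (∀ τ : ℝ, 0 < τ → ∀ Q : ℝ → H →L[ℂ] H, IsDRESolution A B C K 0 τ Q →
        ∀ t ∈ Set.Icc 0 τ, Q t = P t) ∧
      -- exponential convergence in operator norm
      ∃ M > (0 : ℝ), ∃ β > (0 : ℝ), ∀ t : ℝ, 0 ≤ t →
        ‖Pmin - P t‖ ≤ M * Real.exp (-β * t) := by
  have hAe : IsGenerator A fun t => T (max t 0) := hA.extend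
  have hTe : IsExtendedSemigroup fun t => T (max t 0) := hA.isC0Semigroup.extend
  obtain ⟨c, hc, hcb⟩ := exists_norm_le_of_stabilizable hAe hTe hK hB C
  obtain ⟨N, hN, hhalf⟩ := exists_time_norm_sq_le_half hAe hTe hK hC B hc
  obtain ⟨P, hP, h0⟩ := exists_global_riccati hAe hTe hK hB C
  have hpos0 : (P 0).IsPositive := by rw [h0]; exact ContinuousLinearMap.isPositive_zero
  have hpos : ∀ t, 0 ≤ t → (P t).IsPositive := fun t ht =>
    (hP t).isPositive hAe hTe hK hpos0 ⟨ht, le_rfl⟩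
  have hbound : ∀ t, 0 ≤ t → ‖P t‖ ≤ c := fun t ht => hcb t P (hP t) h0 t ⟨ht, le_rfl⟩
  have hgeo := norm_sub_le_geometric hAe hTe hK hP h0 hc hbound hN fun t ht x hx =>
    hhalf t P (hP t) h0 (hbound t (hN.le.trans ht)) ht x hx
  have hcauchy : CauchySeq P := by
    refine Metric.cauchySeq_iff'.2 fun ε hε => ?_
    obtain ⟨n, hn⟩ := exists_pow_lt_of_lt_one (div_pos hε hc) (by norm_num : (1 / 2 : ℝ) < 1)
    refine ⟨n * N, fun t ht => ?_⟩
    have h := hgeo n (n * N) le_rfl (t - n * N) (sub_nonneg.2 ht)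
    rw [add_sub_cancel] at h
    rw [dist_eq_norm]
    refine h.trans_lt ?_
    rw [lt_div_iff₀ hc, one_div, inv_pow] at hn
    rw [div_eq_inv_mul]
    exact hn
  obtain ⟨R, hR⟩ := cauchySeq_tendsto_of_complete hcauchy
  have hRpos : R.IsPositive := isPositive_of_tendsto hR hpos
  refine ⟨R, ⟨hRpos, isARESolution_of_tendsto hP hR hRpos.isSelfAdjoint, fun Q hQ hQA => ?_⟩, P,
    fun τ _ => ?_, hpos, fun τ hτ Q hQ t ht => ?_, 2 * c, by positivity, Real.log 2 / N,
    div_pos (Real.log_pos (by norm_num)) hN, fun t ht => ?_⟩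
  -- The constant solution `Q` dominates `P` at time `0`, hence at all later times, and the order
  -- passes to the limit.
  · refine isPositive_of_tendsto (P := fun t => Q - P t) (tendsto_const_nhds.sub hR) fun t ht => ?_
    exact (hQA.isWeakRiccati t).sub_isPositive hAe hTe hK (hP t) (by simpa [h0] using hQ)
      ⟨ht, le_rfl⟩
  · rw [← h0]
    exact (hP τ).isDRESolution
  · have h := (hQ.isWeakRiccati hτ.le).eq_of_initial_eq hAe hTe hK (hP τ)
      (by rw [projIcc_of_mem hτ.le ⟨le_rfl, hτ.le⟩, hQ.initial, h0]) ht
    rwa [projIcc_of_mem hτ.le ht] at h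
  · refine le_trans ?_ (div_two_pow_le_exp hc)
    -- The geometric bound with `n = ⌊t / N⌋₊` is uniform in `r`, so it survives `r → ∞`.
    have hlim : Tendsto (fun r => ‖P (t + r) - P t‖) atTop (𝓝 ‖R - P t‖) :=
      ((hR.comp (tendsto_atTop_add_const_left atTop t tendsto_id)).sub_const _).norm
    refine le_of_tendsto hlim ?_
    filter_upwards [eventually_ge_atTop 0] with r hr
    refine hgeo _ t ?_ r hr
    exact (le_div_iff₀ hN).1 (Nat.floor_le (by positivity))
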